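/- All quantum systems are finite-dimensional and nonzero, and $H$ denotes von Neumann entropy. A channel with input $A$, output $B$ and environment $E$ is given by an isometry $U:A\to B\otimes E$. A linear entropic formula with $n$ auxiliary variables is given by real coefficients $\alpha_s$, where $s$ ranges over all subcollections of the systems $V_1,\dots,V_n,B,E$. For a state $\phi_{V_1\cdots V_nA}$ put $$f_\alpha(U,\phi)=\sum_s\alpha_s H(s)_\rho,\qquad \rho_{V_1\cdots V_nBE}=(I\otimes U)\,\phi\,(I\otimes U^\dagger),$$ and let $f_\alpha(U)=\sup_\phi f_\alpha(U,\phi)\in(-\infty,+\infty]$, the supremum being over all systems $V_1,\dots,V_n$ and all states $\phi_{V_1\cdots V_nA}$. The formula is bounded if $f_\alpha(U)<\infty$ for at least one $U$. A consistent decoupling $\mathcal D$ consists of pairwise disjoint subcollections $\tilde V_1,\dots,\tilde V_n$ of $\{V_1,\dots,V_n,B_2,E_2\}$ and pairwise disjoint subcollections $\hat V_1,\dots,\hat V_n$ of $\{V_1,\dots,V_n,B_1,E_1\}$ (empty collections are allowed, and mean a one-dimensional system). It is standard if, for every $i$, $\tilde V_i=M_2^iV_i$ with $M_2^i\subseteq\{B_2,E_2\}$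 and $\hat V_i=M_1^iV_i$ with $M_1^i\subseteq\{B_1,E_1\}$. Given $U_1:A_1\to B_1E_1$, $U_2:A_2\to B_2E_2$ and a state $\phi_{V_1\cdots V_nA_1A_2}$, let $\tilde\phi_{\tilde V_1\cdots\tilde V_nA_1}$ be obtained by applying $U_2$ to $A_2$, grouping the systems $V_1,\dots,V_n,B_2,E_2$ into $\tilde V_1,\dots,\tilde V_n$, and tracing out those that are not used; let $\hat\phi_{\hat V_1\cdots\hat V_nA_2}$ be obtained likewise by applying $U_1$ to $A_1$ and grouping $V_1,\dots,V_n,B_1,E_1$ into $\hat V_1,\dots,\hat V_n$. The formula $f_\alpha$ is uniformly subadditive with respect to $\mathcal D$ if $$f_\alpha(U_1\otimes U_2,\phi)\le f_\alpha(U_1,\tilde\phi)+f_\alpha(U_2,\hat\phi)$$ for all $U_1$, $U_2$ and all $\phi_{V_1\cdots V_nA_1A_2}$, where $U_1\otimes U_2$ has output $B_1B_2$ and environment $E_1E_2$. Theorem. Let $f_\alpha$ be a bounded linear entropic formula with $n$ auxiliary variables that is uniformly subadditive with respect to a consistent decoupling that is not standard. Then there are $m\le n$ and a linear entropic formula $f_\beta$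 with $m$ auxiliary variables that is uniformly subadditive with respect to a standard (consistent) decoupling, such that for every $U$ $$f_\alpha(U)=f_\beta(U),$$ and, moreover, one of the two suprema is attained as a finite maximum if and only if the other is. -/

import Mathlib

open scoped Matrix ComplexOrder

noncomputable section

/-- A finite-dimensional quantum system, given by the (finite, nonempty) set labelling an
orthonormal basis: its Hilbert space is `ℂ ^ carrier`. -/
structure QSystem where
  carrier : Type
  [fintype : Fintype carrier]
  [decEq : DecidableEq carrier]
  [nonempty : Nonempty carrier]

namespace QSystem

instance : CoeSort QSystem Type := ⟨QSystem.carrier⟩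

attribute [instance] QSystem.fintype QSystem.decEq QSystem.nonempty

/-- The tensor product of two systems. -/
abbrev prod (X Y : QSystem) : QSystem := ⟨X × Y⟩

end QSystem

/-- The product basis of the tensor product of a family of systems. -/
abbrev Joint {ι : Type} (d : ι → QSystem) : Type := ∀ i, d i

/-- The tensor product of a finite family of systems, as one system
(one-dimensional for the empty family). -/
abbrev QSystem.tensor {ι : Type} [Fintype ι] [DecidableEq ι] (d : ι → QSystem) : QSystem := ⟨Joint d⟩

/-- A density matrix on `ℂ ^ X`. -/
structure QState (X : Type) [Fintype X] [DecidableEq X] where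
  mat : Matrix X X ℂ
  posSemidef : mat.PosSemidef
  trace_eq_one : mat.trace = 1

namespace QState

variable {X Y Z : Type} [Fintype X] [DecidableEq X] [Fintype Y] [DecidableEq Y]
  [Fintype Z] [DecidableEq Z]

/-- The von Neumann entropy `-tr ρ log ρ` (natural logarithm). -/
def entropy (ρ : QState X) : ℝ :=
  ∑ i, Real.negMulLog (ρ.posSemidef.isHermitian.eigenvalues i)

/-- The state `K ρ Kᴴ`, for an isometry `K`. -/
def conj (ρ : QState X) (K : Matrix Y X ℂ) (hK : Kᴴ * K = 1) : QState Y where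
  mat := K * ρ.mat * Kᴴ
  posSemidef := ρ.posSemidef.mul_mul_conjTranspose_same K
  trace_eq_one := by
    rw [Matrix.trace_mul_comm, ← Matrix.mul_assoc, hK, Matrix.one_mul, ρ.trace_eq_one]

/-- The matrix of a partial trace. A basis label `x` of the whole system consists of a part `r x`
that is kept and a part `c x` that is traced out. -/
def marginalMat (M : Matrix X X ℂ) (r : X → Y) (c : X → Z) : Matrix Y Y ℂ := Matrix.of fun y y' =>
  ∑ x, ∑ x', if r x = y ∧ r x' = y' ∧ c x = c x' then M x x' else 0

theorem marginalMat_eq {X Y Z : Type} [Fintype X] [DecidableEq Y] [Fintype Z] [DecidableEq Z]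
    (M : Matrix X X ℂ) (r : X → Y) (c : X → Z) :
    marginalMat M r c = ∑ z : Z, (Matrix.of fun (y : Y) (x : X) =>
      if r x = y ∧ c x = z then (1 : ℂ) else 0) * M *
      (Matrix.of fun (y : Y) (x : X) => if r x = y ∧ c x = z then (1 : ℂ) else 0)ᴴ := by
  ext y y'
  simp only [marginalMat, Matrix.sum_apply, Matrix.mul_apply, Matrix.conjTranspose_apply,
    Matrix.of_apply, Finset.sum_mul]
  rw [Finset.sum_comm]
  conv_rhs => rw [Finset.sum_comm]
  refine Finset.sum_congr rfl fun x' _ => ?_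
  rw [Finset.sum_comm]
  refine Finset.sum_congr rfl fun x _ => ?_
  rw [Finset.sum_eq_single (c x)]
  · by_cases h1 : r x = y <;> by_cases h2 : r x' = y' <;> by_cases h3 : c x' = c x <;>
      simp [h1, h2, h3, eq_comm (a := c x)]
  · intro z _ hz
    simp [Ne.symm hz]
  · simp

/-- The reduced state on the part `r x` of the basis labels `x`, where the part `c x` is traced
out; the two parts together determine `x`. With a trivial second part, this only relabels. -/
def marginal (ρ : QState X) (r : X → Y) (c : X → Z)
    (h : Function.Injective fun x => (r x, c x)) : QState Y where
  mat := marginalMat ρ.mat r c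
  posSemidef := by
    rw [marginalMat_eq]
    exact Matrix.posSemidef_sum _ fun z _ => ρ.posSemidef.mul_mul_conjTranspose_same _
  trace_eq_one := by
    rw [← ρ.trace_eq_one]
    simp only [Matrix.trace, Matrix.diag_apply, marginalMat, Matrix.of_apply]
    rw [Finset.sum_comm]
    refine Finset.sum_congr rfl fun x _ => ?_
    rw [Finset.sum_comm, Finset.sum_eq_single x]
    · simp
    · intro x' _ hx
      refine Finset.sum_eq_zero fun y _ => if_neg ?_
      rintro ⟨h1, h2, h3⟩
      exact hx (h (Prod.ext (h2.trans h1.symm) h3.symm))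
    · simp

/-- The reduced state on the subsystems in `S`, all others being traced out. -/
def reduce {ι : Type} [Fintype ι] [DecidableEq ι] {d : ι → QSystem} (ρ : QState (Joint d))
    (S : Finset ι) : QState (Joint fun i : S => d i) :=
  ρ.marginal (fun x i => x i) (fun x (i : (Sᶜ : Finset ι)) => x i) (by
    intro x x' h
    funext i
    by_cases hi : i ∈ S
    · exact congrFun (congrArg Prod.fst h) ⟨i, hi⟩
    · exact congrFun (congrArg Prod.snd h) ⟨i, Finset.mem_compl.2 hi⟩)

end QState

/-- The systems before use of a channel: auxiliary systems and the channel input `A`. -/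
inductive InLabel (ι : Type)
  | aux (i : ι)
  | A
  deriving DecidableEq, Fintype

/-- The systems after use of a channel: auxiliary systems, the output `B`, the environment `E`. -/
inductive OutLabel (ι : Type)
  | aux (i : ι)
  | B
  | E
  deriving DecidableEq, Fintype

abbrev inSys {ι : Type} (V : ι → QSystem) (A : QSystem) : InLabel ι → QSystem
  | .aux i => V i
  | .A => A

abbrev outSys {ι : Type} (V : ι → QSystem) (B E : QSystem) : OutLabel ι → QSystem
  | .aux i => V i
  | .B => B
  | .E => E

/-- A quantum channel from `A` to `B` with environment `E`, given by its isometry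
`U : A → B ⊗ E`. -/
structure ChannelIsometry (A B E : QSystem) where
  mat : Matrix (B × E) A ℂ
  isometry : matᴴ * mat = 1

namespace ChannelIsometry

variable {A B E : QSystem} {ι : Type} [Fintype ι] [DecidableEq ι]

/-- The matrix of `I ⊗ U`, where `I` acts on the auxiliary systems. -/
def lift (U : ChannelIsometry A B E) (V : ι → QSystem) :
    Matrix (Joint (outSys V B E)) (Joint (inSys V A)) ℂ := Matrix.of fun y x =>
  if ∀ i, (y (.aux i) : V i) = x (.aux i) then U.mat (y .B, y .E) (x .A) else 0

def outEquiv (V : ι → QSystem) (B E : QSystem) :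
    Joint (outSys V B E) ≃ (∀ i, V i) × (B × E) where
  toFun y := (fun i => y (.aux i), (y .B, y .E))
  invFun p
    | .aux i => p.1 i
    | .B => p.2.1
    | .E => p.2.2
  left_inv y := by funext i; cases i <;> rfl
  right_inv p := rfl

theorem lift_isometry (U : ChannelIsometry A B E) (V : ι → QSystem) :
    (U.lift V)ᴴ * U.lift V = 1 := by
  ext x x'
  rw [Matrix.mul_apply, ← (outEquiv V B E).symm.sum_comp, Fintype.sum_prod_type]
  have hU := congrFun (congrFun U.isometry (x .A)) (x' .A)
  rw [Matrix.mul_apply] at hU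
  simp only [Matrix.conjTranspose_apply] at hU ⊢
  rw [Finset.sum_eq_single fun i => x (.aux i)]
  · by_cases h : ∀ i, x (.aux i) = x' (.aux i)
    · have : ∀ p : B × E, star (U.lift V ((outEquiv V B E).symm (fun i => x (.aux i), p)) x) *
          U.lift V ((outEquiv V B E).symm (fun i => x (.aux i), p)) x' =
          star (U.mat p (x .A)) * U.mat p (x' .A) := by
        intro p
        have e1 : U.lift V ((outEquiv V B E).symm (fun i => x (.aux i), p)) x =
            U.mat p (x .A) := if_pos fun i => rfl
        have e2 : U.lift V ((outEquiv V B E).symm (fun i => x (.aux i), p)) x' =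
            U.mat p (x' .A) := if_pos h
        rw [e1, e2]
      rw [Finset.sum_congr rfl fun p _ => this p, hU]
      by_cases hA : x .A = x' .A
      · have : x = x' := by
          funext i
          cases i with
          | aux i => exact h i
          | A => exact hA
        rw [this]
        simp
      · rw [Matrix.one_apply_ne hA, Matrix.one_apply_ne fun e => hA (congrFun e _)]
    · rw [Matrix.one_apply_ne fun e => h fun i => congrFun e _]
      refine Finset.sum_eq_zero fun p _ => ?_
      have e2 : U.lift V ((outEquiv V B E).symm (fun i => x (.aux i), p)) x' = 0 := if_neg h
      rw [e2, mul_zero]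
  · intro v _ hv
    refine Finset.sum_eq_zero fun p _ => ?_
    have e1 : U.lift V ((outEquiv V B E).symm (v, p)) x = 0 :=
      if_neg fun h => hv (funext fun i => h i)
    rw [e1, star_zero, zero_mul]
  · simp

/-- The output state `ρ = (I ⊗ U) φ (I ⊗ U)ᴴ`. -/
def apply (U : ChannelIsometry A B E) {V : ι → QSystem} (φ : QState (Joint (inSys V A))) :
    QState (Joint (outSys V B E)) :=
  φ.conj (U.lift V) (U.lift_isometry V)

/-- The product channel `U₁ ⊗ U₂`, with output `B₁B₂` and environment `E₁E₂`. -/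
def tensor {A₁ B₁ E₁ A₂ B₂ E₂ : QSystem} (U₁ : ChannelIsometry A₁ B₁ E₁)
    (U₂ : ChannelIsometry A₂ B₂ E₂) :
    ChannelIsometry (A₁.prod A₂) (B₁.prod B₂) (E₁.prod E₂) where
  mat := Matrix.of fun p a => U₁.mat (p.1.1, p.2.1) a.1 * U₂.mat (p.1.2, p.2.2) a.2
  isometry := by
    ext a a'
    have h1 := congrFun (congrFun U₁.isometry a.1) a'.1
    have h2 := congrFun (congrFun U₂.isometry a.2) a'.2
    rw [Matrix.mul_apply] at h1 h2
    have e : (1 : Matrix (A₁.prod A₂) (A₁.prod A₂) ℂ) a a' =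
        (1 : Matrix A₁ A₁ ℂ) a.1 a'.1 * (1 : Matrix A₂ A₂ ℂ) a.2 a'.2 := by
      simp only [Matrix.one_apply]
      by_cases g1 : a.1 = a'.1
      · by_cases g2 : a.2 = a'.2
        · rw [if_pos g1, if_pos g2, if_pos (Prod.ext g1 g2), mul_one]
        · rw [if_neg g2, if_neg fun h => g2 (congrArg Prod.snd h), mul_zero]
      · rw [if_neg g1, if_neg fun h => g1 (congrArg Prod.fst h), zero_mul]
    rw [e, ← h1, ← h2, Finset.sum_mul_sum, ← Finset.sum_product', Matrix.mul_apply]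
    refine Fintype.sum_equiv (Equiv.prodProdProdComm B₁ B₂ E₁ E₂) _ _ fun p => ?_
    simp only [Matrix.conjTranspose_apply, Matrix.of_apply, star_mul']
    exact mul_mul_mul_comm _ _ _ _

end ChannelIsometry

/-- The coefficients `α_s` of a linear entropic formula with `n` auxiliary variables, where `s`
runs over all collections of the systems `V₁, …, Vₙ, B, E`. -/
abbrev EntropicFormula (n : ℕ) : Type := Finset (OutLabel (Fin n)) → ℝ

namespace EntropicFormula

variable {n : ℕ} {A B E : QSystem}

/-- `f_α(U, φ) = ∑ s, α_s H(s)`, evaluated on the output state. -/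
def eval (α : EntropicFormula n) (U : ChannelIsometry A B E) {V : Fin n → QSystem}
    (φ : QState (Joint (inSys V A))) : ℝ :=
  ∑ s : Finset (OutLabel (Fin n)), α s * ((U.apply φ).reduce s).entropy

/-- All values `f_α(U, φ)`, where `φ` is any state on `V₁ ⋯ Vₙ A` and the `Vᵢ` are any
finite-dimensional systems. -/
def values (α : EntropicFormula n) (U : ChannelIsometry A B E) : Set ℝ :=
  {x | ∃ (V : Fin n → QSystem) (φ : QState (Joint (inSys V A))), α.eval U φ = x}

/-- The maximized formula `f_α(U)`, which is `⊤` if the values are unbounded above. -/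
def maxValue (α : EntropicFormula n) (U : ChannelIsometry A B E) : EReal :=
  sSup ((fun x : ℝ => (x : EReal)) '' α.values U)

/-- `f_α(U) < ∞` for at least one channel. -/
def IsBounded (α : EntropicFormula n) : Prop :=
  ∃ (A B E : QSystem) (U : ChannelIsometry A B E), α.maxValue U < ⊤

end EntropicFormula

/-- A consistent decoupling: `tilde i` is the collection of the systems `V₁, …, Vₙ, B₂, E₂` that
form `Ṽᵢ`, and `hat i` the collection of the systems `V₁, …, Vₙ, B₁, E₁` that form `V̂ᵢ`. -/
structure ConsistentDecoupling (n : ℕ) where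
  tilde : Fin n → Finset (OutLabel (Fin n))
  hat : Fin n → Finset (OutLabel (Fin n))
  tilde_disjoint : ∀ i j, i ≠ j → Disjoint (tilde i) (tilde j)
  hat_disjoint : ∀ i j, i ≠ j → Disjoint (hat i) (hat j)

/-- `Ṽᵢ = M₂ Vᵢ` and `V̂ᵢ = M₁ Vᵢ`, with `M₂` among `B₂, E₂` and `M₁` among `B₁, E₁`. -/
def ConsistentDecoupling.IsStandard {n : ℕ} (D : ConsistentDecoupling n) : Prop :=
  ∀ i, (∃ M ⊆ ({.B, .E} : Finset (OutLabel (Fin n))), D.tilde i = M ∪ {.aux i}) ∧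
    ∃ M ⊆ ({.B, .E} : Finset (OutLabel (Fin n))), D.hat i = M ∪ {.aux i}

section Decoupling

variable {n : ℕ} {V : Fin n → QSystem}

/-- A state on `V₁ ⋯ Vₙ (A₁A₂)`, as an input to a channel on `A₂` with auxiliary systems
`V₁, …, Vₙ, A₁`. -/
def QState.splitSnd {A₁ A₂ : QSystem} (φ : QState (Joint (inSys V (A₁.prod A₂)))) :
    QState (Joint (inSys (inSys V A₁) A₂)) :=
  φ.marginal (Z := Unit)
    (fun x => fun
      | .aux (.aux i) => x (.aux i)
      | .aux .A => (x .A).1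
      | .A => (x .A).2)
    (fun _ => ()) (by
      intro x x' h
      have h1 := congrArg Prod.fst h
      funext i
      cases i with
      | aux i => exact congrFun h1 (.aux (.aux i))
      | A => exact Prod.ext (congrFun h1 (.aux .A)) (congrFun h1 .A))

/-- A state on `V₁ ⋯ Vₙ (A₁A₂)`, as an input to a channel on `A₁` with auxiliary systems
`V₁, …, Vₙ, A₂`. -/
def QState.splitFst {A₁ A₂ : QSystem} (φ : QState (Joint (inSys V (A₁.prod A₂)))) :
    QState (Joint (inSys (inSys V A₂) A₁)) :=
  φ.marginal (Z := Unit)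
    (fun x => fun
      | .aux (.aux i) => x (.aux i)
      | .aux .A => (x .A).2
      | .A => (x .A).1)
    (fun _ => ()) (by
      intro x x' h
      have h1 := congrArg Prod.fst h
      funext i
      cases i with
      | aux i => exact congrFun h1 (.aux (.aux i))
      | A => exact Prod.ext (congrFun h1 .A) (congrFun h1 (.aux .A)))

/-- From a basis label of `V₁ ⋯ Vₙ A B E`, forget the part on `A`. -/
def forgetA {A B E : QSystem} (x : Joint (outSys (inSys V A) B E)) : Joint (outSys V B E)
  | .aux i => x (.aux (.aux i))
  | .B => x .B
  | .E => x .E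

/-- The composite systems made of the collections `G i` of the systems `V₁, …, Vₙ, B, E`. -/
abbrev groupSys (V : Fin n → QSystem) (B E : QSystem) (G : Fin n → Finset (OutLabel (Fin n)))
    (i : Fin n) : QSystem :=
  QSystem.tensor fun j : G i => outSys V B E j

/-- From a state on `V₁ ⋯ Vₙ A B E`, make a state on `W₁ ⋯ Wₙ A`, where `Wᵢ` consists of the
systems in `G i`; the systems among `V₁, …, Vₙ, B, E` in none of the `G i` are traced out. -/
def QState.regroup {A B E : QSystem} (ρ : QState (Joint (outSys (inSys V A) B E)))
    (G : Fin n → Finset (OutLabel (Fin n))) : QState (Joint (inSys (groupSys V B E G) A)) :=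
  ρ.marginal
    (fun x => fun
      | .aux i => fun j : G i => forgetA x j
      | .A => x (.aux .A))
    (fun x (j : {j // ∀ i, j ∉ G i}) => forgetA x j) (by
      intro x x' h
      have h1 := congrArg Prod.fst h
      have h2 := congrArg Prod.snd h
      have key : ∀ j, forgetA x j = forgetA x' j := by
        intro j
        by_cases hj : ∃ i, j ∈ G i
        · obtain ⟨i, hi⟩ := hj
          exact congrFun (congrFun h1 (.aux i)) ⟨j, hi⟩
        · exact congrFun h2 ⟨j, fun i hi => hj ⟨i, hi⟩⟩
      funext j
      rcases j with (i | _) | _ | _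
      · exact key (.aux i)
      · exact congrFun h1 .A
      · exact key .B
      · exact key .E)

/-- The state `φ̃` on `Ṽ₁ ⋯ Ṽₙ A₁`: apply `U₂` to `A₂`, then regroup `V₁, …, Vₙ, B₂, E₂`. -/
def ConsistentDecoupling.tildeState (D : ConsistentDecoupling n) {A₁ A₂ B₂ E₂ : QSystem}
    (U₂ : ChannelIsometry A₂ B₂ E₂) (φ : QState (Joint (inSys V (A₁.prod A₂)))) :
    QState (Joint (inSys (groupSys V B₂ E₂ D.tilde) A₁)) :=
  (U₂.apply φ.splitSnd).regroup D.tilde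

/-- The state `φ̂` on `V̂₁ ⋯ V̂ₙ A₂`: apply `U₁` to `A₁`, then regroup `V₁, …, Vₙ, B₁, E₁`. -/
def ConsistentDecoupling.hatState (D : ConsistentDecoupling n) {A₁ A₂ B₁ E₁ : QSystem}
    (U₁ : ChannelIsometry A₁ B₁ E₁) (φ : QState (Joint (inSys V (A₁.prod A₂)))) :
    QState (Joint (inSys (groupSys V B₁ E₁ D.hat) A₂)) :=
  (U₁.apply φ.splitFst).regroup D.hat

end Decoupling

/-- `f_α(U₁ ⊗ U₂, φ) ≤ f_α(U₁, φ̃) + f_α(U₂, φ̂)` for all channels and all states. -/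
def EntropicFormula.UniformlySubadditive {n : ℕ} (α : EntropicFormula n)
    (D : ConsistentDecoupling n) : Prop :=
  ∀ (A₁ B₁ E₁ A₂ B₂ E₂ : QSystem) (U₁ : ChannelIsometry A₁ B₁ E₁)
    (U₂ : ChannelIsometry A₂ B₂ E₂) (V : Fin n → QSystem)
    (φ : QState (Joint (inSys V (A₁.prod A₂)))),
    α.eval (U₁.tensor U₂) φ ≤ α.eval U₁ (D.tildeState U₂ φ) + α.eval U₂ (D.hatState U₁ φ)

end

/-! Let one of the two channels in the subadditivity inequality be the channel between
one-dimensional systems. The term belonging to it is nonpositive: entropies of product states add,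
so a positive value could be added any number of times to a value at a channel where the formula is
bounded (`eval_trivial_nonpos`). The other term is the value at a state in which the `Vⱼ` have
merely been regrouped: `Vⱼ` becomes part of the block that contains it, or is discarded. So `tilde`
and `hat` each define a partial self-map of the index set along which regrouping never decreases the
formula (`raises_tilde`, `raises_hat`).

Partial maps with this property (`Raises`) form a finite monoid. Let `P` be the range of a member of
minimal rank. For every member `u` there is a member `w` with range in `P` such that `u` followed by
`w` is the identity on `P` (`exists_range_leftInverse`). The formula `β` is `α` with every `Vᵢ`, `i
∉ P`, made one-dimensional, and its decoupling is the old one followed by regrouping along `w`, with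
one `w` for `tilde` and one for `hat`. Since `w` only raises the right-hand side, subadditivity
survives (`UniformlySubadditive.comap`); since `u` followed by `w` fixes `P`, each remaining `Vᵢ`
lies in its own block, which is standardness (`restrictBlocks_standard`). The values of `β` are
values of `α`, and regrouping along `w` bounds every value of `α` by one of `β`, so suprema and
maxima agree.

Formally, every state involved is a marginal of a common one, and its entropies are compared through
partial maps of system labels (`pullback`). -/

set_option linter.unusedSectionVars false

/-! ### Marginals of states and their entropies -/

namespace QState

variable {X Y Z Y' Z' : Type} [Fintype X] [DecidableEq X] [Fintype Y] [DecidableEq Y]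
  [Fintype Z] [DecidableEq Z] [Fintype Y'] [DecidableEq Y'] [Fintype Z'] [DecidableEq Z']

theorem ext_mat {ρ σ : QState X} (h : ρ.mat = σ.mat) : ρ = σ := by
  cases ρ; cases σ; cases h; rfl

/-- The entropy can be read off from any isometric diagonalization. -/
theorem entropy_eq_of_diagonal (ρ : QState X) (K : Matrix X Y ℂ) (hK : Kᴴ * K = 1) (d : Y → ℝ)
    (h : ρ.mat = K * Matrix.diagonal (fun i => (d i : ℂ)) * Kᴴ) :
    ρ.entropy = ∑ i, Real.negMulLog (d i) := by
  -- Up to powers of `X`, the matrix and the diagonal one have the same characteristic polynomial.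
  -- The surplus roots are zero and contribute nothing, as `negMulLog 0 = 0`.
  have h1 := Matrix.charpoly_mul_comm' (K * Matrix.diagonal (fun i => (d i : ℂ))) Kᴴ
  rw [← Matrix.mul_assoc, hK, Matrix.one_mul, ← h, Matrix.charpoly_diagonal] at h1
  have hne : ∏ i, (Polynomial.X - Polynomial.C (d i : ℂ)) ≠ 0 :=
    Finset.prod_ne_zero_iff.2 fun i _ => Polynomial.X_sub_C_ne_zero _
  have h2 := congrArg Polynomial.roots h1
  rw [Polynomial.roots_mul (mul_ne_zero (pow_ne_zero _ Polynomial.X_ne_zero)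
      (Matrix.charpoly_monic _).ne_zero),
    Polynomial.roots_mul (mul_ne_zero (pow_ne_zero _ Polynomial.X_ne_zero) hne),
    Polynomial.roots_X_pow, Polynomial.roots_X_pow,
    ρ.posSemidef.isHermitian.roots_charpoly_eq_eigenvalues, Polynomial.roots_prod _ _ hne] at h2
  have h3 := congrArg (fun s => (s.map fun z : ℂ => Real.negMulLog z.re).sum) h2
  unfold entropy
  simpa [Multiset.map_nsmul, Multiset.sum_nsmul] using h3

theorem exists_diagonal {M : Matrix X X ℂ} (hM : M.IsHermitian) :
    ∃ P : Matrix X X ℂ, Pᴴ * P = 1 ∧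
      M = P * Matrix.diagonal (fun i => (hM.eigenvalues i : ℂ)) * Pᴴ :=
  ⟨hM.eigenvectorUnitary, Unitary.star_mul_self_of_mem hM.eigenvectorUnitary.2, by
    conv_lhs => rw [hM.spectral_theorem, Unitary.conjStarAlgAut_apply]
    rfl⟩

theorem entropy_eq_of_isometry_conj {M : Matrix Z Z ℂ} (hM : M.IsHermitian) (ρ : QState X)
    (K : Matrix X Z ℂ) (hK : Kᴴ * K = 1) (h : ρ.mat = K * M * Kᴴ) :
    ρ.entropy = ∑ i, Real.negMulLog (hM.eigenvalues i) := by
  obtain ⟨P, hP, e⟩ := exists_diagonal hM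
  refine ρ.entropy_eq_of_diagonal (K * P) ?_ _ ?_
  · rw [Matrix.conjTranspose_mul, Matrix.mul_assoc, ← Matrix.mul_assoc Kᴴ, hK, Matrix.one_mul, hP]
  · rw [Matrix.conjTranspose_mul, h]
    conv_lhs => rw [e]
    simp only [Matrix.mul_assoc]

theorem marginalMat_congr_right (M : Matrix X X ℂ) (r : X → Y) {c : X → Z} {c' : X → Z'}
    (h : ∀ x x', c x = c x' ↔ c' x = c' x') : marginalMat M r c = marginalMat M r c' := by
  ext y y'
  simp only [marginalMat, h]

theorem marginalMat_marginalMat (M : Matrix X X ℂ) (r : X → Y) (c : X → Z) (r' : Y → Y')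
    (c' : Y → Z') : marginalMat (marginalMat M r c) r' c' =
      marginalMat M (r' ∘ r) (fun x => (c' (r x), c x)) := by
  ext y y'
  simp only [marginalMat, Matrix.of_apply]
  have : ∀ z z' : Y, (if r' z = y ∧ r' z' = y' ∧ c' z = c' z' then
      ∑ x, ∑ x', if r x = z ∧ r x' = z' ∧ c x = c x' then M x x' else 0 else 0) =
      ∑ x, ∑ x', if r x = z then if r x' = z' then
        if r' z = y ∧ r' z' = y' ∧ c' z = c' z' ∧ c x = c x' then M x x' else 0 else 0 else 0 := by
    intro z z'
    split_ifs with h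
    · refine Finset.sum_congr rfl fun x _ => Finset.sum_congr rfl fun x' _ => ?_
      by_cases h1 : r x = z <;> by_cases h2 : r x' = z' <;> simp [h, h1, h2]
    · symm
      refine Finset.sum_eq_zero fun x _ => Finset.sum_eq_zero fun x' _ => ?_
      have : ¬ (r' z = y ∧ r' z' = y' ∧ c' z = c' z' ∧ c x = c x') := by tauto
      simp [this]
  simp only [this]
  rw [Finset.sum_congr rfl fun z _ => Finset.sum_comm, Finset.sum_comm]
  refine Finset.sum_congr rfl fun x _ => ?_
  rw [Finset.sum_congr rfl fun z _ => Finset.sum_comm, Finset.sum_comm]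
  refine Finset.sum_congr rfl fun x' _ => ?_
  simp

/-- The isometry between basis labels induced by an injection. -/
def injMat (i : Y → Z) : Matrix Z Y ℂ := Matrix.of fun z y => if i y = z then 1 else 0

theorem injMat_isometry {i : Y → Z} (hi : Function.Injective i) : (injMat i)ᴴ * injMat i = 1 := by
  ext y y'
  simp only [injMat, Matrix.mul_apply, Matrix.conjTranspose_apply, Matrix.of_apply,
    Matrix.one_apply]
  by_cases h : y = y'
  · simp [h]
  · simp [h, hi.eq_iff]

theorem marginalMat_comp (M : Matrix X X ℂ) (r : X → Y) (c : X → Z) (i : Y → Y') :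
    marginalMat M (i ∘ r) c = injMat i * marginalMat M r c * (injMat i)ᴴ := by
  have h1 : marginalMat (marginalMat M r c) i (fun _ => ()) = marginalMat M (i ∘ r) c := by
    rw [marginalMat_marginalMat]
    exact marginalMat_congr_right _ _ (by simp)
  rw [← h1, marginalMat_eq]
  simp [injMat]

theorem marginalMat_posSemidef {M : Matrix X X ℂ} (hM : M.PosSemidef) (r : X → Y) (c : X → Z) :
    (marginalMat M r c).PosSemidef := by
  rw [marginalMat_eq]
  exact Matrix.posSemidef_sum _ fun z _ => hM.mul_mul_conjTranspose_same _

/-- `ρ'` is the reduced state of `ρ` on the part `r`, the part `c` being traced out. -/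
def IsMarginal (ρ' : QState Y) (ρ : QState X) (r : X → Y) (c : X → Z) : Prop :=
  ρ'.mat = marginalMat ρ.mat r c

theorem isMarginal_marginal (ρ : QState X) (r : X → Y) (c : X → Z) (h) :
    (ρ.marginal r c h).IsMarginal ρ r c := rfl

theorem IsMarginal.trans {W : Type} [Fintype W] [DecidableEq W] {ρ'' : QState W} {ρ' : QState Y}
    {ρ : QState X} {r : X → Y}
    {c : X → Z} {r' : Y → W} {c' : Y → Z'} (h' : ρ''.IsMarginal ρ' r' c')
    (h : ρ'.IsMarginal ρ r c) : ρ''.IsMarginal ρ (r' ∘ r) (fun x => (c' (r x), c x)) := by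
  unfold IsMarginal at *
  rw [h', h, marginalMat_marginalMat]

theorem IsMarginal.congr_right {ρ' : QState Y} {ρ : QState X} {r r' : X → Y} {c : X → Z}
    {c' : X → Z'} (h : ρ'.IsMarginal ρ r c) (hr : r = r')
    (hc : ∀ x x', c x = c x' ↔ c' x = c' x') :
    ρ'.IsMarginal ρ r' c' := by
  subst hr
  exact (show _ = _ from h).trans (marginalMat_congr_right _ _ hc)

/-- A marginal that only uses the data of another marginal is a marginal of the latter. -/
theorem IsMarginal.factor {W T : Type} [Fintype W] [DecidableEq W] [Fintype T] [DecidableEq T]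
    {ρ₁ : QState Y} {ρ₂ : QState W} {ρ : QState X} {r₁ : X → Y}
    {c₁ : X → Z} {r₂ : X → W} {c₂ : X → Z'} (h₁ : ρ₁.IsMarginal ρ r₁ c₁)
    (h₂ : ρ₂.IsMarginal ρ r₂ c₂) (R : W → Y) (C : W → T) (hr : r₁ = R ∘ r₂)
    (hc : ∀ x x', c₁ x = c₁ x' ↔ C (r₂ x) = C (r₂ x') ∧ c₂ x = c₂ x') :
    ρ₁.IsMarginal ρ₂ R C := by
  unfold IsMarginal at *
  rw [h₁, h₂, marginalMat_marginalMat, hr]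
  exact marginalMat_congr_right _ _ fun x x' => by rw [hc, Prod.mk.injEq]

/-- The entropy of a marginal depends only on the equivalence relations that the kept part and the
traced out part define on the basis labels. -/
theorem entropy_eq_of_isMarginal {ρ₁ : QState Y} {ρ₂ : QState Y'} {ρ : QState X} {r₁ : X → Y}
    {c₁ : X → Z} {r₂ : X → Y'} {c₂ : X → Z'} (h₁ : ρ₁.IsMarginal ρ r₁ c₁)
    (h₂ : ρ₂.IsMarginal ρ r₂ c₂) (hr : ∀ x x', r₁ x = r₁ x' ↔ r₂ x = r₂ x')
    (hc : ∀ x x', c₁ x = c₁ x' ↔ c₂ x = c₂ x') : ρ₁.entropy = ρ₂.entropy := by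
  classical
  -- Both states are isometric images of one marginal on the range of `r₁`: the first through the
  -- inclusion, the second through `i₂`, which is injective by `hr`.
  let r₀ : X → Set.range r₁ := fun x => ⟨r₁ x, x, rfl⟩
  have hp := marginalMat_posSemidef ρ.posSemidef r₀ c₁
  let i₂ : Set.range r₁ → Y' := fun y => r₂ y.2.choose
  have e2 : r₂ = i₂ ∘ r₀ := by
    funext x
    exact (hr _ _).1 (r₀ x).2.choose_spec.symm
  have hi : Function.Injective i₂ := by
    intro y y' h
    have := (hr _ _).2 h
    rw [y.2.choose_spec, y'.2.choose_spec] at this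
    exact Subtype.ext this
  rw [entropy_eq_of_isometry_conj hp.isHermitian ρ₁ (injMat Subtype.val)
      (injMat_isometry Subtype.val_injective),
    entropy_eq_of_isometry_conj hp.isHermitian ρ₂ (injMat i₂) (injMat_isometry hi)]
  · rw [← marginalMat_comp, ← e2, (show _ = _ from h₂)]
    exact marginalMat_congr_right _ _ fun x x' => (hc x x').symm
  · rw [← marginalMat_comp]
    exact h₁

/-- The product state. -/
def kron (ρ : QState X) (σ : QState Y) : QState (X × Y) where
  mat := Matrix.kroneckerMap (· * ·) ρ.mat σ.mat
  posSemidef := ρ.posSemidef.kronecker σ.posSemidef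
  trace_eq_one := by
    rw [Matrix.trace_kronecker, ρ.trace_eq_one, σ.trace_eq_one, one_mul]

theorem sum_eigenvalues (ρ : QState X) : ∑ i, ρ.posSemidef.isHermitian.eigenvalues i = 1 := by
  have h := ρ.posSemidef.isHermitian.trace_eq_sum_eigenvalues
  rw [ρ.trace_eq_one] at h
  exact Complex.ofReal_injective (by push_cast; exact h.symm)

/-- The eigenvalues are the products `p q`, and `negMulLog (p q) = q negMulLog p + p negMulLog q`;
each spectrum sums to one. -/
theorem entropy_kron (ρ : QState X) (σ : QState Y) :
    (ρ.kron σ).entropy = ρ.entropy + σ.entropy := by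
  obtain ⟨P, hP, eP⟩ := exists_diagonal ρ.posSemidef.isHermitian
  obtain ⟨Q, hQ, eQ⟩ := exists_diagonal σ.posSemidef.isHermitian
  rw [entropy_eq_of_diagonal (ρ.kron σ) (Matrix.kroneckerMap (· * ·) P Q) (by
      rw [Matrix.conjTranspose_kronecker, ← Matrix.mul_kronecker_mul, hP, hQ,
        Matrix.one_kronecker_one])
    (fun i => ρ.posSemidef.isHermitian.eigenvalues i.1 * σ.posSemidef.isHermitian.eigenvalues i.2)
    ?_]
  · simp only [Real.negMulLog_mul, Finset.sum_add_distrib, Fintype.sum_prod_type]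
    rw [Finset.sum_comm]
    simp only [← Finset.sum_mul, ← Finset.mul_sum, sum_eigenvalues, one_mul, entropy]
  · have : (Matrix.diagonal fun i : X × Y => ((ρ.posSemidef.isHermitian.eigenvalues i.1 *
        σ.posSemidef.isHermitian.eigenvalues i.2 : ℝ) : ℂ)) = Matrix.kroneckerMap (· * ·)
        (Matrix.diagonal fun i => (ρ.posSemidef.isHermitian.eigenvalues i : ℂ))
        (Matrix.diagonal fun i => (σ.posSemidef.isHermitian.eigenvalues i : ℂ)) := by
      rw [Matrix.diagonal_kronecker_diagonal]
      simp
    rw [this, Matrix.conjTranspose_kronecker, ← Matrix.mul_kronecker_mul,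
      ← Matrix.mul_kronecker_mul, ← eP, ← eQ]
    rfl

theorem IsMarginal.kron {X₁ X₂ Y₁ Y₂ Z₁ Z₂ : Type} [Fintype X₁] [DecidableEq X₁] [Fintype X₂]
    [DecidableEq X₂] [Fintype Y₁] [DecidableEq Y₁] [Fintype Y₂] [DecidableEq Y₂] [Fintype Z₁]
    [DecidableEq Z₁] [Fintype Z₂] [DecidableEq Z₂] {ρ₁ : QState X₁} {ρ₂ : QState X₂}
    {σ₁ : QState Y₁} {σ₂ : QState Y₂} {r₁ : X₁ → Y₁} {c₁ : X₁ → Z₁} {r₂ : X₂ → Y₂} {c₂ : X₂ → Z₂}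
    (h₁ : σ₁.IsMarginal ρ₁ r₁ c₁) (h₂ : σ₂.IsMarginal ρ₂ r₂ c₂) :
    (σ₁.kron σ₂).IsMarginal (ρ₁.kron ρ₂) (Prod.map r₁ r₂) (Prod.map c₁ c₂) := by
  unfold IsMarginal at *
  ext y y'
  simp only [QState.kron, Matrix.kroneckerMap_apply, h₁, h₂, marginalMat, Matrix.of_apply,
    Finset.sum_mul_sum, Fintype.sum_prod_type]
  refine Finset.sum_congr rfl fun x _ => Finset.sum_congr rfl fun x₂ _ => ?_
  refine Finset.sum_congr rfl fun x' _ => Finset.sum_congr rfl fun x₂' _ => ?_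
  simp only [Prod.map, Prod.ext_iff, ite_zero_mul_ite_zero]
  congr 1
  exact propext ⟨fun h => ⟨⟨h.1.1, h.2.1⟩, ⟨h.1.2.1, h.2.2.1⟩, h.1.2.2, h.2.2.2⟩,
    fun h => ⟨⟨h.1.1, h.2.1.1, h.2.2.1⟩, h.1.2, h.2.1.2, h.2.2.2⟩⟩

end QState

/-! ### Marginals under isometries -/

noncomputable section

/-- The operator that keeps the part `r` of the basis labels whose part `c` is `z`. -/
def selMat {X Y Z : Type} [DecidableEq Y] [DecidableEq Z] (r : X → Y) (c : X → Z) (z : Z) :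
    Matrix Y X ℂ :=
  Matrix.of fun y x => if r x = y ∧ c x = z then 1 else 0

section selMat

variable {X Y Z W : Type} [Fintype X] [DecidableEq X] [Fintype Y] [DecidableEq Y]
  [Fintype Z] [DecidableEq Z] [Fintype W] [DecidableEq W]

theorem mul_selMat_apply (K : Matrix W Y ℂ) (r : X → Y) (c : X → Z) (z : Z) (w : W) (x : X) :
    (K * selMat r c z) w x = if c x = z then K w (r x) else 0 := by
  by_cases h : c x = z <;> simp [selMat, Matrix.mul_apply, h]

theorem selMat_mul_apply (K : Matrix X W ℂ) (r : X → Y) (c : X → Z) (z : Z) (y : Y) (w : W) :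
    (selMat r c z * K) y w = ∑ x, if r x = y ∧ c x = z then K x w else 0 := by
  simp [selMat, Matrix.mul_apply]

theorem selMat_mul_apply_of_inverse (K : Matrix X W ℂ) {r : X → Y} {i : Y → X}
    (hi : ∀ x y, r x = y ↔ x = i y) (c : X → Z) (z : Z) (y : Y) (w : W) :
    (selMat r c z * K) y w = if c (i y) = z then K (i y) w else 0 := by
  rw [selMat_mul_apply, Finset.sum_eq_single (i y)]
  · simp [hi]
  · intro x _ hx
    simp [hi, hx]
  · simp

/-- A partial trace is a sum over `z` of conjugations by `selMat r c z`, so it is enough that the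
two isometries intertwine these operators term by term. -/
theorem QState.IsMarginal.conj {X' Y' : Type} [Fintype X'] [DecidableEq X'] [Fintype Y']
    [DecidableEq Y'] {ρ' : QState Y} {ρ : QState X} {r : X → Y} {c : X → Z}
    (h : ρ'.IsMarginal ρ r c) (K : Matrix X' X ℂ) (hK : Kᴴ * K = 1) (K' : Matrix Y' Y ℂ)
    (hK' : K'ᴴ * K' = 1) (r' : X' → Y') (c' : X' → Z)
    (hc : ∀ z, K' * selMat r c z = selMat r' c' z * K) :
    (ρ'.conj K' hK').IsMarginal (ρ.conj K hK) r' c' := by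
  unfold QState.IsMarginal at *
  simp only [QState.conj, h, QState.marginalMat_eq, Matrix.mul_sum, Matrix.sum_mul]
  refine Finset.sum_congr rfl fun z _ => ?_
  have e : K' * selMat r c z * ρ.mat * (K' * selMat r c z)ᴴ =
      selMat r' c' z * K * ρ.mat * (selMat r' c' z * K)ᴴ := by rw [hc]
  simp only [Matrix.conjTranspose_mul, Matrix.mul_assoc] at e ⊢
  exact e

end selMat

/-! ### Regrouping the auxiliary systems of a channel -/

section Labels

variable {ι κ : Type} [Fintype ι] [DecidableEq ι] [Fintype κ] [DecidableEq κ]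
  {V : ι → QSystem} {W : κ → QSystem} {A B E : QSystem} {Z : Type} [Fintype Z] [DecidableEq Z]

/-- The auxiliary part of a basis label before use of a channel. -/
def auxPart (x : Joint (inSys V A)) : Joint V := fun i => x (.aux i)

/-- The auxiliary part of a basis label after use of a channel. -/
def outAuxPart (x : Joint (outSys V B E)) : Joint V := fun i => x (.aux i)

/-- Act on the auxiliary part of a basis label. -/
def auxIn (r : Joint V → Joint W) (x : Joint (inSys V A)) : Joint (inSys W A)
  | .aux i => r (auxPart x) i
  | .A => x .A

/-- Act on the auxiliary part of a basis label. -/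
def auxOut (r : Joint V → Joint W) (x : Joint (outSys V B E)) : Joint (outSys W B E)
  | .aux i => r (outAuxPart x) i
  | .B => x .B
  | .E => x .E

/-- A channel commutes with operations on the auxiliary systems. -/
theorem QState.IsMarginal.apply {φ' : QState (Joint (inSys W A))} {φ : QState (Joint (inSys V A))}
    {r : Joint V → Joint W} {c : Joint V → Z}
    (h : φ'.IsMarginal φ (auxIn r) (fun x => c (auxPart x))) (U : ChannelIsometry A B E) :
    (U.apply φ').IsMarginal (U.apply φ) (auxOut r) (fun x => c (outAuxPart x)) := by
  refine h.conj _ _ _ _ _ _ fun z => ?_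
  ext y x
  rw [mul_selMat_apply, selMat_mul_apply]
  -- `I ⊗ U` leaves the auxiliary part unchanged, so only this output label can contribute to the
  -- sum.
  let y₀ : Joint (outSys V B E) := fun
    | .aux i => x (.aux i)
    | .B => y .B
    | .E => y .E
  rw [Finset.sum_eq_single y₀]
  · have h0 : outAuxPart y₀ = auxPart x := rfl
    have h1 : auxOut r y₀ = y ↔ ∀ i, (y (.aux i) : W i) = auxIn (A := A) r x (.aux i) := by
      refine ⟨fun e i => (congrFun e (.aux i)).symm, fun e => ?_⟩
      funext i
      cases i with
      | aux i => exact (e i).symm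
      | B => rfl
      | E => rfl
    have h2 : U.lift V y₀ x = U.mat (y .B, y .E) (x .A) := if_pos fun i => rfl
    rw [h0, h2]
    by_cases g1 : c (auxPart x) = z <;>
      by_cases g2 : ∀ i, (y (.aux i) : W i) = auxIn (A := A) r x (.aux i)
    · rw [if_pos g1, if_pos ⟨h1.2 g2, g1⟩]
      exact if_pos g2
    · rw [if_pos g1, if_neg fun g => g2 (h1.1 g.1)]
      exact if_neg g2
    · rw [if_neg g1, if_neg fun g => g1 g.2]
    · rw [if_neg g1, if_neg fun g => g1 g.2]
  · intro y' _ hy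
    split_ifs with g
    · refine if_neg fun g' => hy ?_
      funext i
      cases i with
      | aux i => exact g' i
      | B => exact congrFun g.1 .B
      | E => exact congrFun g.1 .E
    · rfl
  · simp

theorem QState.reduce_isMarginal {d : ι → QSystem} (ρ : QState (Joint d)) (S : Finset ι) :
    (ρ.reduce S).IsMarginal ρ (fun x (i : S) => x i)
      (fun x (i : (Sᶜ : Finset ι)) => x i) :=
  ρ.isMarginal_marginal _ _ _

theorem OutLabel.forall_iff {p : OutLabel ι → Prop} :
    (∀ l, p l) ↔ (∀ i, p (.aux i)) ∧ p .B ∧ p .E :=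
  ⟨fun h => ⟨fun _ => h _, h _, h _⟩, fun h l => by
    cases l
    exacts [h.1 _, h.2.1, h.2.2]⟩

theorem restrict_eq_iff {d : ι → QSystem} (S : Finset ι) (x x' : Joint d) :
    ((fun i : S => x i) = fun i : S => x' i) ↔ ∀ i, i ∈ S → x i = x' i :=
  ⟨fun h i hi => congrFun h ⟨i, hi⟩, fun h => funext fun i => h i i.2⟩

/-- The entropy `H(s)` of the output state. -/
def outEntropy (U : ChannelIsometry A B E) (φ : QState (Joint (inSys V A)))
    (s : Finset (OutLabel ι)) : ℝ :=
  ((U.apply φ).reduce s).entropy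

/-- The entropy depends only on when two labels agree on the kept part and when on the traced-out
part. The traced-out part for `φ'` consists of the systems outside `s'` together with `c`. -/
theorem outEntropy_eq {φ' : QState (Joint (inSys W A))} {φ : QState (Joint (inSys V A))}
    {r : Joint V → Joint W} {c : Joint V → Z}
    (h : φ'.IsMarginal φ (auxIn r) (fun x => c (auxPart x))) (U : ChannelIsometry A B E)
    (s' : Finset (OutLabel κ)) (s : Finset (OutLabel ι))
    (hB : .B ∈ s' ↔ .B ∈ s) (hE : .E ∈ s' ↔ .E ∈ s)
    (hr : ∀ v v', (∀ i, .aux i ∈ s' → r v i = r v' i) ↔ ∀ j, .aux j ∈ s → v j = v' j)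
    (hc : ∀ v v', ((∀ i, .aux i ∉ s' → r v i = r v' i) ∧ c v = c v') ↔
      ∀ j, .aux j ∉ s → v j = v' j) :
    outEntropy U φ' s' = outEntropy U φ s := by
  refine QState.entropy_eq_of_isMarginal
    (((U.apply φ').reduce_isMarginal s').trans (h.apply U)) ((U.apply φ).reduce_isMarginal s)
    (fun x x' => ?_) (fun x x' => ?_)
  · refine (restrict_eq_iff s' (auxOut r x) (auxOut r x')).trans
      (Iff.trans ?_ (restrict_eq_iff s x x').symm)
    rw [OutLabel.forall_iff, OutLabel.forall_iff, hB, hE]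
    exact and_congr_left fun _ => hr (outAuxPart x) (outAuxPart x')
  · rw [Prod.mk.injEq]
    refine ((restrict_eq_iff s'ᶜ (auxOut r x) (auxOut r x')).and Iff.rfl).trans
      (Iff.trans ?_ (restrict_eq_iff sᶜ x x').symm)
    simp only [Finset.mem_compl]
    rw [OutLabel.forall_iff, OutLabel.forall_iff, hB, hE, and_right_comm]
    exact and_congr_left fun _ => hc (outAuxPart x) (outAuxPart x')

open Classical in
/-- The systems of a collection `t` of new systems, where the auxiliary system `j` is a part of the
new auxiliary system `w j`, or is discarded if `w j = none`. -/
def pullback (w : ι → Option κ) (t : Finset (OutLabel κ)) : Finset (OutLabel ι) :=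
  Finset.univ.filter fun
    | .aux j => ∃ i, w j = some i ∧ .aux i ∈ t
    | .B => .B ∈ t
    | .E => .E ∈ t

@[simp] theorem aux_mem_pullback (w : ι → Option κ) (t : Finset (OutLabel κ)) (j : ι) :
    .aux j ∈ pullback w t ↔ ∃ i, w j = some i ∧ .aux i ∈ t := by simp [pullback]

@[simp] theorem B_mem_pullback (w : ι → Option κ) (t : Finset (OutLabel κ)) :
    .B ∈ pullback w t ↔ .B ∈ t := by simp [pullback]

@[simp] theorem E_mem_pullback (w : ι → Option κ) (t : Finset (OutLabel κ)) :
    .E ∈ pullback w t ↔ .E ∈ t := by simp [pullback]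

theorem OutLabel.finset_ext {s t : Finset (OutLabel ι)}
    (h : ∀ i, OutLabel.aux i ∈ s ↔ OutLabel.aux i ∈ t) (hB : .B ∈ s ↔ .B ∈ t)
    (hE : .E ∈ s ↔ .E ∈ t) : s = t := by
  ext l
  cases l
  exacts [h _, hB, hE]

/-- This reduces the comparison of successive regroupings to an identity between composites of
partial maps. -/
theorem pullback_pullback {μ : Type} [Fintype μ] [DecidableEq μ] (w : ι → Option κ)
    (w' : κ → Option μ) (t : Finset (OutLabel μ)) :
    pullback w (pullback w' t) = pullback (fun j => (w j).bind w') t := by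
  refine OutLabel.finset_ext (fun j => ?_) (by simp) (by simp)
  simp only [aux_mem_pullback, Option.bind_eq_some_iff]
  exact ⟨fun ⟨i, h, k, h', hk⟩ => ⟨k, ⟨i, h, h'⟩, hk⟩,
    fun ⟨k, ⟨i, h, h'⟩, hk⟩ => ⟨i, h, k, h', hk⟩⟩

/-- A version of `outEntropy_eq` for an operation that regroups the auxiliary systems. -/
theorem outEntropy_eq_pullback {φ' : QState (Joint (inSys W A))} {φ : QState (Joint (inSys V A))}
    {r : Joint V → Joint W} {c : Joint V → Z}
    (h : φ'.IsMarginal φ (auxIn r) (fun x => c (auxPart x))) (U : ChannelIsometry A B E)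
    (w : ι → Option κ)
    (hr : ∀ v v' i, r v i = r v' i ↔ ∀ j, w j = some i → v j = v' j)
    (hc : ∀ v v', c v = c v' ↔ ∀ j, w j = none → v j = v' j) (t : Finset (OutLabel κ)) :
    outEntropy U φ' t = outEntropy U φ (pullback w t) := by
  refine outEntropy_eq h U _ _ (by simp) (by simp) (fun v v' => ?_) fun v v' => ?_
  · simp only [hr, aux_mem_pullback]
    exact ⟨fun g j ⟨i, e, hi⟩ => g i hi j e, fun g i hi j e => g j ⟨i, e, hi⟩⟩
  · simp only [hr, hc, aux_mem_pullback]
    refine ⟨fun g j hj => ?_, fun g => ⟨fun i hi j e => g j ?_, fun j e => g j ?_⟩⟩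
    · cases e : w j with
      | none => exact g.2 j e
      | some i => exact g.1 i (fun hi => hj ⟨i, e, hi⟩) j e
    · rintro ⟨i', e', hi'⟩
      rw [e, Option.some.injEq] at e'
      exact hi (e' ▸ hi')
    · rintro ⟨i', e', -⟩
      rw [e] at e'
      cases e'

/-- The systems formed of the auxiliary systems with the same value of `w`. -/
abbrev pushSys (w : ι → Option κ) (V : ι → QSystem) (i : κ) : QSystem :=
  QSystem.tensor fun j : {j // w j = some i} => V j

/-- The parts of a basis label on the regrouped systems. -/
def pushLabel (w : ι → Option κ) (v : Joint V) : Joint (pushSys w V) := fun _ j => v j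

/-- The part of a basis label on the discarded systems. -/
def dropLabel (w : ι → Option κ) (v : Joint V) : Joint fun j : {j // w j = none} => V j :=
  fun j => v j

theorem pushLabel_eq_iff (w : ι → Option κ) (v v' : Joint V) (i : κ) :
    pushLabel w v i = pushLabel w v' i ↔ ∀ j, w j = some i → v j = v' j :=
  ⟨fun h j hj => congrFun h ⟨j, hj⟩, fun h => funext fun j => h j j.2⟩

theorem dropLabel_eq_iff (w : ι → Option κ) (v v' : Joint V) :
    dropLabel w v = dropLabel w v' ↔ ∀ j, w j = none → v j = v' j :=
  ⟨fun h j hj => congrFun h ⟨j, hj⟩, fun h => funext fun j => h j j.2⟩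

/-- Regroup the auxiliary systems. -/
def QState.push (w : ι → Option κ) (φ : QState (Joint (inSys V A))) :
    QState (Joint (inSys (pushSys w V) A)) :=
  φ.marginal (auxIn (pushLabel w)) (fun x => dropLabel w (auxPart x)) (by
    intro x x' h
    have h1 := congrArg Prod.fst h
    have h2 := congrArg Prod.snd h
    funext l
    cases l with
    | A => exact congrFun h1 .A
    | aux j =>
      cases e : w j with
      | none => exact (dropLabel_eq_iff w (auxPart x) (auxPart x')).1 h2 j e
      | some i =>
        exact (pushLabel_eq_iff w (auxPart x) (auxPart x') i).1 (congrFun h1 (.aux i)) j e)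

theorem QState.push_isMarginal (w : ι → Option κ) (φ : QState (Joint (inSys V A))) :
    (φ.push w).IsMarginal φ (auxIn (pushLabel w)) (fun x => dropLabel w (auxPart x)) :=
  φ.isMarginal_marginal _ _ _

theorem outEntropy_push (U : ChannelIsometry A B E) (w : ι → Option κ)
    (φ : QState (Joint (inSys V A))) (t : Finset (OutLabel κ)) :
    outEntropy U (φ.push w) t = outEntropy U φ (pullback w t) :=
  outEntropy_eq_pullback (φ.push_isMarginal w) U w (pushLabel_eq_iff w) (dropLabel_eq_iff w) t

end Labels


/-! ### The decoupled states as regroupings of one state -/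

section Assoc

variable {n m : ℕ} {V : Fin n → QSystem} {W : Fin m → QSystem} {A A₁ A₂ B E B₁ E₁ B₂ E₂ : QSystem}
  {Z : Type} [Fintype Z] [DecidableEq Z]

/-- Count the output and the environment of a channel among the auxiliary systems. -/
def assocLabel (x : Joint (outSys (inSys V A) B E)) : Joint (inSys (outSys V B E) A)
  | .aux l => forgetA x l
  | .A => x (.aux .A)

theorem assocLabel_injective :
    Function.Injective (assocLabel : Joint (outSys (inSys V A) B E) → _) := by
  intro x x' h
  funext l
  rcases l with (i | _) | _ | _
  · exact congrFun h (.aux (.aux i))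
  · exact congrFun h .A
  · exact congrFun h (.aux .B)
  · exact congrFun h (.aux .E)

/-- The output state of a channel on `A₂`, as an input to a channel on `A₁`. -/
def QState.assoc (ρ : QState (Joint (outSys (inSys V A) B E))) :
    QState (Joint (inSys (outSys V B E) A)) :=
  ρ.marginal assocLabel (fun _ => ()) fun _ _ h => assocLabel_injective (congrArg Prod.fst h)

theorem QState.assoc_isMarginal (ρ : QState (Joint (outSys (inSys V A) B E))) :
    ρ.assoc.IsMarginal ρ assocLabel fun _ => () :=
  ρ.isMarginal_marginal _ _ _

open Classical in
/-- The index of the collection that contains a given system. -/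
def blockOf (G : Fin n → Finset (OutLabel (Fin n))) (l : OutLabel (Fin n)) : Option (Fin n) :=
  if h : ∃ i, l ∈ G i then some h.choose else none

theorem blockOf_eq_some_iff {G : Fin n → Finset (OutLabel (Fin n))}
    (hG : ∀ i j, i ≠ j → Disjoint (G i) (G j)) (l : OutLabel (Fin n)) (i : Fin n) :
    blockOf G l = some i ↔ l ∈ G i := by
  unfold blockOf
  split_ifs with h
  · rw [Option.some.injEq]
    refine ⟨fun e => e ▸ h.choose_spec, fun hi => ?_⟩
    by_contra hne
    exact Finset.disjoint_left.1 (hG _ _ hne) h.choose_spec hi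
  · simpa using fun hi => h ⟨i, hi⟩

theorem blockOf_eq_none_iff (G : Fin n → Finset (OutLabel (Fin n))) (l : OutLabel (Fin n)) :
    blockOf G l = none ↔ ∀ i, l ∉ G i := by
  unfold blockOf
  split_ifs with h
  · simpa using h
  · simpa using h

/-- Disjointness of the collections is what lets them be encoded by the single partial map `blockOf
G`. -/
theorem outEntropy_regroup {G : Fin n → Finset (OutLabel (Fin n))}
    (hG : ∀ i j, i ≠ j → Disjoint (G i) (G j)) (U : ChannelIsometry A B₁ E₁)
    (ρ : QState (Joint (outSys (inSys V A) B E))) (t : Finset (OutLabel (Fin n))) :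
    outEntropy U (ρ.regroup G) t = outEntropy U ρ.assoc (pullback (blockOf G) t) := by
  let r : Joint (outSys V B E) → Joint (groupSys V B E G) := fun v i j => v j
  let c : Joint (outSys V B E) → Joint (fun j : {j // ∀ i, j ∉ G i} => outSys V B E j) :=
    fun v j => v j
  have h : (ρ.regroup G).IsMarginal ρ.assoc (auxIn r) (fun x => c (auxPart x)) := by
    refine QState.IsMarginal.factor (c₁ := fun x => c (forgetA x)) (ρ.isMarginal_marginal _ _ _)
      ρ.assoc_isMarginal _ _ ?_ fun x x' => ?_
    · funext x l
      cases l <;> rfl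
    · exact (and_iff_left rfl).symm
  refine outEntropy_eq_pullback h U (blockOf G) (fun v v' i => ?_) (fun v v' => ?_) t
  · simp only [blockOf_eq_some_iff hG]
    exact restrict_eq_iff (G i) v v'
  · simp only [blockOf_eq_none_iff]
    exact ⟨fun g j hj => congrFun g ⟨j, hj⟩, fun g => funext fun j => g j j.2⟩

/-- Extend an assignment of systems by the output and the environment. -/
def liftMap (w : Fin m → Option (Fin n)) : OutLabel (Fin m) → Option (OutLabel (Fin n))
  | .aux j => (w j).map .aux
  | .B => some .B
  | .E => some .E

/-- Regrouping the `Vⱼ` commutes with the use of `U₂`. Once `B₂` and `E₂` count as auxiliary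
systems, it is the regrouping that fixes these two. -/
theorem outEntropy_assoc_apply {ψ' : QState (Joint (inSys (inSys W A₁) A₂))}
    {ψ : QState (Joint (inSys (inSys V A₁) A₂))} {r : Joint V → Joint W} {c : Joint V → Z}
    (h : ψ'.IsMarginal ψ (auxIn (auxIn r)) fun x => c (auxPart (auxPart x)))
    (U₁ : ChannelIsometry A₁ B₁ E₁) (U₂ : ChannelIsometry A₂ B₂ E₂) (w : Fin n → Option (Fin m))
    (hr : ∀ v v' i, r v i = r v' i ↔ ∀ j, w j = some i → v j = v' j)
    (hc : ∀ v v', c v = c v' ↔ ∀ j, w j = none → v j = v' j)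
    (t : Finset (OutLabel (OutLabel (Fin m)))) :
    outEntropy U₁ (U₂.apply ψ').assoc t =
      outEntropy U₁ (U₂.apply ψ).assoc (pullback (liftMap w) t) := by
  have h1 : (U₂.apply ψ').assoc.IsMarginal (U₂.apply ψ).assoc (auxIn (auxOut r))
      (fun x => c (outAuxPart (auxPart x))) := by
    refine QState.IsMarginal.factor ((U₂.apply ψ').assoc_isMarginal.trans
      (QState.IsMarginal.apply (c := fun x => c (auxPart x)) h U₂)) (U₂.apply ψ).assoc_isMarginal
      _ (fun x => c (outAuxPart (auxPart x))) ?_ fun x x' => ?_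
    · funext x l
      rcases l with (i | _ | _) | _ <;> rfl
    · rw [Prod.mk.injEq]
      exact and_comm
  refine outEntropy_eq_pullback (c := fun v => c (outAuxPart v)) h1 U₁ (liftMap w)
    (fun v v' i => ?_) (fun v v' => ?_) t
  · rw [OutLabel.forall_iff]
    cases i with
    | aux i =>
      refine (hr (outAuxPart v) (outAuxPart v') i).trans ⟨fun g => ⟨fun j hj => g j ?_, ?_, ?_⟩,
        fun g j hj => g.1 j ?_⟩
      · simpa [liftMap] using hj
      · simp [liftMap]
      · simp [liftMap]
      · simpa [liftMap] using hj
    | B =>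
      refine ⟨fun g => ⟨fun j hj => ?_, fun _ => g, fun hj => ?_⟩, fun g => g.2.1 rfl⟩
      · simp [liftMap] at hj
      · simp [liftMap] at hj
    | E =>
      refine ⟨fun g => ⟨fun j hj => ?_, fun hj => ?_, fun _ => g⟩, fun g => g.2.2 rfl⟩
      · simp [liftMap] at hj
      · simp [liftMap] at hj
  · refine (hc (outAuxPart v) (outAuxPart v')).trans ?_
    rw [OutLabel.forall_iff]
    refine ⟨fun g => ⟨fun j hj => g j ?_, ?_, ?_⟩, fun g j hj => g.1 j ?_⟩
    · simpa [liftMap] using hj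
    · simp [liftMap]
    · simp [liftMap]
    · simpa [liftMap] using hj

theorem QState.splitSnd_isMarginal (φ : QState (Joint (inSys V (A₁.prod A₂)))) :
    φ.splitSnd.IsMarginal φ
      (fun x => fun
        | .aux (.aux i) => x (.aux i)
        | .aux .A => (x .A).1
        | .A => (x .A).2) (fun _ => ()) :=
  φ.isMarginal_marginal _ _ _

theorem QState.splitFst_isMarginal (φ : QState (Joint (inSys V (A₁.prod A₂)))) :
    φ.splitFst.IsMarginal φ
      (fun x => fun
        | .aux (.aux i) => x (.aux i)
        | .aux .A => (x .A).2
        | .A => (x .A).1) (fun _ => ()) :=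
  φ.isMarginal_marginal _ _ _

theorem QState.IsMarginal.splitSnd {φ' : QState (Joint (inSys W (A₁.prod A₂)))}
    {φ : QState (Joint (inSys V (A₁.prod A₂)))} {r : Joint V → Joint W} {c : Joint V → Z}
    (h : φ'.IsMarginal φ (auxIn r) fun x => c (auxPart x)) :
    φ'.splitSnd.IsMarginal φ.splitSnd (auxIn (auxIn r)) fun x => c (auxPart (auxPart x)) := by
  refine QState.IsMarginal.factor (φ'.splitSnd_isMarginal.trans h) φ.splitSnd_isMarginal _
    (fun x => c (auxPart (auxPart x))) ?_ fun x x' => ?_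
  · funext x l
    rcases l with (i | _) | _ <;> rfl
  · rw [Prod.mk.injEq]
    exact and_comm

theorem QState.IsMarginal.splitFst {φ' : QState (Joint (inSys W (A₁.prod A₂)))}
    {φ : QState (Joint (inSys V (A₁.prod A₂)))} {r : Joint V → Joint W} {c : Joint V → Z}
    (h : φ'.IsMarginal φ (auxIn r) fun x => c (auxPart x)) :
    φ'.splitFst.IsMarginal φ.splitFst (auxIn (auxIn r)) fun x => c (auxPart (auxPart x)) := by
  refine QState.IsMarginal.factor (φ'.splitFst_isMarginal.trans h) φ.splitFst_isMarginal _
    (fun x => c (auxPart (auxPart x))) ?_ fun x x' => ?_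
  · funext x l
    rcases l with (i | _) | _ <;> rfl
  · rw [Prod.mk.injEq]
    exact and_comm

/-- All entropies are referred to one state that involves neither `w` nor `D`, so that decouplings
of different numbers of systems become comparable. -/
theorem outEntropy_tildeState_push (D : ConsistentDecoupling m) (w : Fin n → Option (Fin m))
    (U₁ : ChannelIsometry A₁ B₁ E₁) (U₂ : ChannelIsometry A₂ B₂ E₂)
    (φ : QState (Joint (inSys V (A₁.prod A₂)))) (t : Finset (OutLabel (Fin m))) :
    outEntropy U₁ (D.tildeState U₂ (φ.push w)) t = outEntropy U₁ (U₂.apply φ.splitSnd).assoc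
      (pullback (fun l => (liftMap w l).bind (blockOf D.tilde)) t) := by
  rw [← pullback_pullback, ConsistentDecoupling.tildeState, outEntropy_regroup D.tilde_disjoint]
  exact outEntropy_assoc_apply (φ.push_isMarginal w).splitSnd U₁ U₂ w (pushLabel_eq_iff w)
    (dropLabel_eq_iff w) _

theorem outEntropy_hatState_push (D : ConsistentDecoupling m) (w : Fin n → Option (Fin m))
    (U₁ : ChannelIsometry A₁ B₁ E₁) (U₂ : ChannelIsometry A₂ B₂ E₂)
    (φ : QState (Joint (inSys V (A₁.prod A₂)))) (t : Finset (OutLabel (Fin m))) :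
    outEntropy U₂ (D.hatState U₁ (φ.push w)) t = outEntropy U₂ (U₁.apply φ.splitFst).assoc
      (pullback (fun l => (liftMap w l).bind (blockOf D.hat)) t) := by
  rw [← pullback_pullback, ConsistentDecoupling.hatState, outEntropy_regroup D.hat_disjoint]
  exact outEntropy_assoc_apply (φ.push_isMarginal w).splitFst U₂ U₁ w (pushLabel_eq_iff w)
    (dropLabel_eq_iff w) _

end Assoc

/-! ### The one-dimensional channel -/

section Trivial

/-- The one-dimensional system. -/
abbrev QSystem.trivial : QSystem := ⟨Unit⟩

/-- The channel between one-dimensional systems. -/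
def ChannelIsometry.trivial :
    ChannelIsometry QSystem.trivial QSystem.trivial QSystem.trivial where
  mat := Matrix.of fun _ _ => 1
  isometry := by
    ext
    simp [Matrix.mul_apply]

variable {ι : Type} [Fintype ι] [DecidableEq ι] {V : ι → QSystem} {A B E : QSystem}

theorem ChannelIsometry.trivial_apply_isMarginal (ψ : QState (Joint (inSys V QSystem.trivial))) :
    (ChannelIsometry.trivial.apply ψ).IsMarginal ψ
      (fun x => fun
        | .aux i => x (.aux i)
        | .B => ()
        | .E => ()) (fun _ => ()) := by
  unfold QState.IsMarginal
  rw [QState.marginalMat_eq, Fintype.sum_unique]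
  have : ChannelIsometry.trivial.lift V = Matrix.of fun
      (y : Joint (outSys V QSystem.trivial QSystem.trivial))
      (x : Joint (inSys V QSystem.trivial)) => if (fun
        | .aux i => x (.aux i)
        | .B => ()
        | .E => () : Joint (outSys V QSystem.trivial QSystem.trivial)) = y ∧
        () = default then (1 : ℂ) else 0 := by
    ext y x
    refine if_congr ⟨fun h => ⟨?_, rfl⟩, fun h i => (congrFun h.1 (.aux i)).symm⟩ rfl rfl
    funext l
    cases l with
    | aux i => exact (h i).symm
    | B => rfl
    | E => rfl
  rw [← this]
  rfl

/-- Relabel the input of a channel along a bijection. -/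
def QState.relabelA {A' : QSystem} (φ : QState (Joint (inSys V A))) (e : A ≃ A') :
    QState (Joint (inSys V A')) :=
  φ.marginal (fun x => fun
      | .aux i => x (.aux i)
      | .A => e (x .A)) (fun _ => ()) (by
    intro x x' h
    have h1 := congrArg Prod.fst h
    funext l
    cases l with
    | aux i => exact congrFun h1 (.aux i)
    | A => exact e.injective (congrFun h1 .A))

theorem QState.relabelA_isMarginal {A' : QSystem} (φ : QState (Joint (inSys V A))) (e : A ≃ A') :
    (φ.relabelA e).IsMarginal φ (fun x => fun
      | .aux i => x (.aux i)
      | .A => e (x .A)) (fun _ => ()) :=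
  φ.isMarginal_marginal _ _ _

/-- The entropies do not depend on the labels of the channel's input, output and environment. -/
theorem outEntropy_relabel {A' B' E' : QSystem} (U : ChannelIsometry A B E)
    (U' : ChannelIsometry A' B' E') (eA : A ≃ A') (eB : B ≃ B') (eE : E ≃ E')
    (hU : ∀ a b e, U'.mat (eB b, eE e) (eA a) = U.mat (b, e) a) (φ : QState (Joint (inSys V A)))
    (s : Finset (OutLabel ι)) : outEntropy U' (φ.relabelA eA) s = outEntropy U φ s := by
  let R : Joint (outSys V B E) → Joint (outSys V B' E') := fun y => fun
    | .aux i => y (.aux i)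
    | .B => eB (y .B)
    | .E => eE (y .E)
  have h : (U'.apply (φ.relabelA eA)).IsMarginal (U.apply φ) R (fun _ => ()) := by
    refine (φ.relabelA_isMarginal eA).conj _ _ _ _ _ _ fun z => ?_
    ext y x
    rw [mul_selMat_apply, selMat_mul_apply_of_inverse _ (i := fun y => fun
      | .aux i => y (.aux i)
      | .B => eB.symm (y .B)
      | .E => eE.symm (y .E))]
    · refine congrArg (fun t : ℂ => if () = z then t else 0) ?_
      refine if_congr Iff.rfl ?_ rfl
      rw [← hU, Equiv.apply_symm_apply, Equiv.apply_symm_apply]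
    · intro x y
      constructor
      · rintro rfl
        funext l
        cases l with
        | aux i => rfl
        | B => exact (eB.symm_apply_apply _).symm
        | E => exact (eE.symm_apply_apply _).symm
      · rintro rfl
        funext l
        cases l with
        | aux i => rfl
        | B => exact eB.apply_symm_apply _
        | E => exact eE.apply_symm_apply _
  refine QState.entropy_eq_of_isMarginal ((QState.reduce_isMarginal _ s).trans h)
    (QState.reduce_isMarginal _ s) (fun x x' => ?_) fun x x' => ?_
  all_goals
    first
    | refine (restrict_eq_iff s (R x) (R x')).trans (Iff.trans ?_ (restrict_eq_iff s x x').symm)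
    | rw [Prod.mk.injEq, and_iff_left rfl]
      refine (restrict_eq_iff sᶜ (R x) (R x')).trans (Iff.trans ?_ (restrict_eq_iff sᶜ x x').symm)
    rw [OutLabel.forall_iff, OutLabel.forall_iff]
    exact and_congr Iff.rfl (and_congr (imp_congr_right fun _ => eB.injective.eq_iff)
      (imp_congr_right fun _ => eE.injective.eq_iff))

variable {n : ℕ} {V : Fin n → QSystem}

/-- The systems `A₂`, `B₂`, `E₂` are one-dimensional here and carry no entropy, so membership of
`B₂` and `E₂` in a collection is irrelevant. -/
theorem outEntropy_assoc_trivial_splitSnd (U : ChannelIsometry A B E)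
    (φ : QState (Joint (inSys V A))) (t : Finset (OutLabel (OutLabel (Fin n)))) :
    outEntropy U (ChannelIsometry.trivial.apply
      (φ.relabelA (A' := A.prod QSystem.trivial) (Equiv.prodPUnit A).symm).splitSnd).assoc t =
      outEntropy U φ (pullback (fun j => some (.aux j)) t) := by
  have h : (ChannelIsometry.trivial.apply (φ.relabelA (A' := A.prod QSystem.trivial)
      (Equiv.prodPUnit A).symm).splitSnd).assoc.IsMarginal φ
      (auxIn fun v => fun
        | .aux i => v i
        | .B => ()
        | .E => ()) (fun _ => ()) := by
    refine ((QState.assoc_isMarginal _).trans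
      ((ChannelIsometry.trivial_apply_isMarginal _).trans
      ((QState.splitSnd_isMarginal _).trans (QState.relabelA_isMarginal _ _)))).congr_right ?_
      fun _ _ => by simp
    funext x l
    rcases l with (i | _ | _) | _ <;> rfl
  refine outEntropy_eq_pullback (c := fun _ => ()) h U _ (fun v v' i => ?_) (fun v v' => by simp) t
  cases i with
  | aux i => simp
  | B => simp
  | E => simp

theorem outEntropy_assoc_trivial_splitFst (U : ChannelIsometry A B E)
    (φ : QState (Joint (inSys V A))) (t : Finset (OutLabel (OutLabel (Fin n)))) :
    outEntropy U (ChannelIsometry.trivial.apply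
      (φ.relabelA (A' := QSystem.trivial.prod A) (Equiv.punitProd A).symm).splitFst).assoc t =
      outEntropy U φ (pullback (fun j => some (.aux j)) t) := by
  have h : (ChannelIsometry.trivial.apply (φ.relabelA (A' := QSystem.trivial.prod A)
      (Equiv.punitProd A).symm).splitFst).assoc.IsMarginal φ
      (auxIn fun v => fun
        | .aux i => v i
        | .B => ()
        | .E => ()) (fun _ => ()) := by
    refine ((QState.assoc_isMarginal _).trans
      ((ChannelIsometry.trivial_apply_isMarginal _).trans
      ((QState.splitFst_isMarginal _).trans (QState.relabelA_isMarginal _ _)))).congr_right ?_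
      fun _ _ => by simp
    funext x l
    rcases l with (i | _ | _) | _ <;> rfl
  refine outEntropy_eq_pullback (c := fun _ => ()) h U _ (fun v v' i => ?_) (fun v v' => by simp) t
  cases i with
  | aux i => simp
  | B => simp
  | E => simp

end Trivial

/-! ### Additivity under independent auxiliary systems -/

section Product

variable {ι : Type} [Fintype ι] [DecidableEq ι] {V W : ι → QSystem} {A B E : QSystem}

/-- The product of an input state with a state on further auxiliary systems. -/
def QState.prodAux (φ : QState (Joint (inSys V A))) (ψ : QState (Joint (inSys W QSystem.trivial))) :
    QState (Joint (inSys (fun i => (V i).prod (W i)) A)) :=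
  (φ.kron ψ).marginal (fun p => fun
    | .aux i => (p.1 (.aux i), p.2 (.aux i))
    | .A => p.1 .A) (fun _ => ()) (by
    intro p p' h
    have h1 := congrArg Prod.fst h
    refine Prod.ext (funext fun l => ?_) (funext fun l => ?_)
    · cases l with
      | aux i => exact congrArg Prod.fst (congrFun h1 (.aux i))
      | A => exact congrFun h1 .A
    · cases l with
      | aux i => exact congrArg Prod.snd (congrFun h1 (.aux i))
      | A => rfl)

theorem QState.prodAux_isMarginal (φ : QState (Joint (inSys V A)))
    (ψ : QState (Joint (inSys W QSystem.trivial))) :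
    (φ.prodAux ψ).IsMarginal (φ.kron ψ) (fun p => fun
      | .aux i => (p.1 (.aux i), p.2 (.aux i))
      | .A => p.1 .A) (fun _ => ()) :=
  (φ.kron ψ).isMarginal_marginal _ _ _

theorem QState.kron_conj {X Y X' Y' : Type} [Fintype X] [DecidableEq X] [Fintype Y] [DecidableEq Y]
    [Fintype X'] [DecidableEq X'] [Fintype Y'] [DecidableEq Y'] (ρ : QState X) (σ : QState Y)
    (K : Matrix X' X ℂ) (hK : Kᴴ * K = 1) (L : Matrix Y' Y ℂ) (hL : Lᴴ * L = 1) :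
    (ρ.conj K hK).kron (σ.conj L hL) = (ρ.kron σ).conj (Matrix.kroneckerMap (· * ·) K L) (by
      rw [Matrix.conjTranspose_kronecker, ← Matrix.mul_kronecker_mul, hK, hL,
        Matrix.one_kronecker_one]) := by
  refine QState.ext_mat ?_
  simp only [QState.kron, QState.conj]
  rw [Matrix.conjTranspose_kronecker, Matrix.mul_kronecker_mul, Matrix.mul_kronecker_mul]

/-- Up to relabelling, the output state is the product of the two output states, and so are its
marginals; `entropy_kron` then applies. -/
theorem outEntropy_prodAux (U : ChannelIsometry A B E) (φ : QState (Joint (inSys V A)))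
    (ψ : QState (Joint (inSys W QSystem.trivial))) (s : Finset (OutLabel ι)) :
    outEntropy U (φ.prodAux ψ) s = outEntropy U φ s + outEntropy ChannelIsometry.trivial ψ s := by
  let R : Joint (outSys V B E) × Joint (outSys W QSystem.trivial QSystem.trivial) →
      Joint (outSys (fun i => (V i).prod (W i)) B E) := fun p => fun
    | .aux i => (p.1 (.aux i), p.2 (.aux i))
    | .B => p.1 .B
    | .E => p.1 .E
  have h : (U.apply (φ.prodAux ψ)).IsMarginal
      ((U.apply φ).kron (ChannelIsometry.trivial.apply ψ)) R (fun _ => ()) := by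
    simp only [ChannelIsometry.apply, QState.kron_conj]
    refine (φ.prodAux_isMarginal ψ).conj _ _ _ _ _ _ fun z => ?_
    ext y p
    rw [mul_selMat_apply, selMat_mul_apply_of_inverse _ (i := fun y => (fun
      | .aux i => (y (.aux i)).1
      | .B => y .B
      | .E => y .E, fun
      | .aux i => (y (.aux i)).2
      | .B => ()
      | .E => ()))]
    · refine congrArg (fun t : ℂ => if () = z then t else 0) ?_
      simp only [Matrix.kroneckerMap_apply, ChannelIsometry.lift, Matrix.of_apply,
        ChannelIsometry.trivial, mul_ite, mul_one, mul_zero, ← ite_and]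
      exact if_congr ⟨fun g => ⟨fun i => congrArg Prod.snd (g i), fun i => congrArg Prod.fst (g i)⟩,
        fun g i => Prod.ext (g.2 i) (g.1 i)⟩ rfl rfl
    · intro p y
      constructor
      · rintro rfl
        refine Prod.ext (funext fun l => ?_) (funext fun l => ?_) <;> cases l <;> rfl
      · rintro rfl
        funext l
        cases l <;> rfl
  refine Eq.trans ?_ (QState.entropy_kron _ _)
  refine QState.entropy_eq_of_isMarginal ((QState.reduce_isMarginal _ s).trans h)
    (QState.IsMarginal.kron (QState.reduce_isMarginal _ s) (QState.reduce_isMarginal _ s))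
    (fun x x' => ?_) fun x x' => ?_
  all_goals
    first
    | refine (restrict_eq_iff s (R x) (R x')).trans (Iff.trans ?_ (Prod.mk.injEq ..).to_iff.symm)
      refine Iff.trans ?_ ((restrict_eq_iff s x.1 x'.1).and (restrict_eq_iff s x.2 x'.2)).symm
    | rw [Prod.mk.injEq, and_iff_left rfl]
      refine (restrict_eq_iff sᶜ (R x) (R x')).trans (Iff.trans ?_ (Prod.mk.injEq ..).to_iff.symm)
      refine Iff.trans ?_ ((restrict_eq_iff sᶜ x.1 x'.1).and (restrict_eq_iff sᶜ x.2 x'.2)).symm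
    rw [OutLabel.forall_iff, OutLabel.forall_iff, OutLabel.forall_iff]
    exact ⟨fun g => ⟨⟨fun i hi => congrArg Prod.fst (g.1 i hi), g.2⟩,
        fun i hi => congrArg Prod.snd (g.1 i hi), fun _ => rfl, fun _ => rfl⟩,
      fun g => ⟨fun i hi => Prod.ext (g.1.1 i hi) (g.2.1 i hi), g.1.2⟩⟩

end Product


/-! ### Monoids of partial maps -/

section PartialMaps

variable {κ : Type} [Fintype κ] [DecidableEq κ]

/-- The iterates of a partial map. -/
def partialIterate (g : κ → Option κ) : ℕ → κ → Option κ
  | 0 => some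
  | k + 1 => fun j => (g j).bind (partialIterate g k)

/-- In a monoid of partial self-maps, let `w` be a map of minimal rank, with range `P`. Then every
member of the monoid has a left inverse on `P` in the monoid, whose range lies in `P`. -/
theorem exists_range_leftInverse (S : Set (κ → Option κ)) (hone : some ∈ S)
    (hmul : ∀ u ∈ S, ∀ w ∈ S, (fun j => (u j).bind w) ∈ S) :
    ∃ P : Set κ, ∀ u ∈ S, ∃ w ∈ S, (∀ j i, w j = some i → i ∈ P) ∧
      ∀ i ∈ P, (u i).bind w = some i := by
  let rank : (κ → Option κ) → ℕ := fun w => {i | ∃ j, w j = some i}.ncard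
  obtain ⟨w, hw, hmin⟩ := (measure rank).wf.has_min S ⟨_, hone⟩
  let P : Set κ := {i | ∃ j, w j = some i}
  refine ⟨P, fun u hu => ?_⟩
  let g : κ → Option κ := fun j => (u j).bind w
  have hgP : ∀ j i, g j = some i → i ∈ P := by
    intro j i h
    obtain ⟨k, -, hk⟩ := Option.bind_eq_some_iff.1 h
    exact ⟨k, hk⟩
  have hgS : g ∈ S := hmul u hu w hw
  have hsurj : ∀ i : P, ∃ j : P, g j = some (i : κ) := by
    -- The map `w` followed by `g` has its range in `P`; minimality of the rank forces equality, so
    -- `g` maps `P` onto `P`.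
    have hsub : {i | ∃ j, (w j).bind g = some i} ⊆ P := by
      rintro i ⟨j, h⟩
      obtain ⟨k, -, hk⟩ := Option.bind_eq_some_iff.1 h
      exact hgP k i hk
    have heq := Set.eq_of_subset_of_ncard_le hsub
      (not_lt.1 (hmin _ (hmul w hw g hgS))) P.toFinite
    rintro ⟨i, hi⟩
    rw [← heq] at hi
    obtain ⟨j, h⟩ := hi
    obtain ⟨k, hk, hk'⟩ := Option.bind_eq_some_iff.1 h
    exact ⟨⟨k, j, hk⟩, hk'⟩
  choose h hh using hsurj
  have hinj : Function.Injective h := by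
    intro i i' e
    have := hh i
    rw [e, hh i'] at this
    exact Subtype.ext (Option.some.inj this).symm
  -- A section of a surjection of the finite set `P` onto itself is a permutation; hence `g` is
  -- defined on all of `P` and inverts `σ` there.
  let σ : Equiv.Perm P := Equiv.ofBijective h (Finite.injective_iff_bijective.1 hinj)
  have hiter : ∀ (k : ℕ) (i : P), partialIterate g k ((σ ^ k) i : P) = some (i : κ) := by
    intro k
    induction k with
    | zero => intro i; rfl
    | succ k ih =>
      intro i
      change (g ((σ ^ (k + 1)) i : P)).bind _ = _
      rw [pow_succ', Equiv.Perm.mul_apply]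
      change (g (h ((σ ^ k) i) : P)).bind _ = _
      rw [hh, Option.bind_some, ih]
  -- With `L + 1` the order of `σ`, the iterate of `g` of order `L + 1` is the identity on `P`.
  obtain ⟨L, hL⟩ := Nat.exists_eq_add_of_lt (orderOf_pos σ)
  have hid : ∀ i ∈ P, partialIterate g (L + 1) i = some i := by
    intro i hi
    have := hiter (L + 1) ⟨i, hi⟩
    rwa [show L + 1 = orderOf σ by omega, pow_orderOf_eq_one,
      show orderOf σ = L + 1 by omega] at this
  have hS : ∀ k, partialIterate g k ∈ S := by
    intro k
    induction k with
    | zero => exact hone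
    | succ k ih => exact hmul g hgS _ ih
  have hP : ∀ k, ∀ j ∈ P, ∀ i, partialIterate g k j = some i → i ∈ P := by
    intro k
    induction k with
    | zero =>
      intro j hj i e
      exact Option.some.inj e ▸ hj
    | succ k ih =>
      intro j hj i e
      obtain ⟨l, hl, hl'⟩ := Option.bind_eq_some_iff.1 e
      exact ih l (hgP j l hl) i hl'
  -- The left inverse is `w` followed by `L` iterates of `g`: preceded by `u`, it becomes `L + 1`
  -- iterates of `g`.
  refine ⟨_, hmul w hw _ (hS L), fun j i e => ?_, fun i hi => ?_⟩
  · obtain ⟨l, hl, hl'⟩ := Option.bind_eq_some_iff.1 e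
    exact hP L l ⟨j, hl⟩ i hl'
  · rw [← Option.bind_assoc]
    exact hid i hi

end PartialMaps

/-! ### Regroupings that do not decrease the formula -/

namespace EntropicFormula

variable {n m : ℕ} {A B E : QSystem}

theorem eval_eq (α : EntropicFormula n) (U : ChannelIsometry A B E) {V : Fin n → QSystem}
    (φ : QState (Joint (inSys V A))) : α.eval U φ = ∑ s, α s * outEntropy U φ s := rfl

theorem eval_prodAux (α : EntropicFormula n) (U : ChannelIsometry A B E) {V W : Fin n → QSystem}
    (φ : QState (Joint (inSys V A))) (ψ : QState (Joint (inSys W QSystem.trivial))) :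
    α.eval U (φ.prodAux ψ) = α.eval U φ + α.eval ChannelIsometry.trivial ψ := by
  simp only [eval_eq, outEntropy_prodAux, mul_add, Finset.sum_add_distrib]

theorem _root_.QState.nonempty (X : Type) [Fintype X] [DecidableEq X] [Nonempty X] :
    Nonempty (QState X) := by
  obtain ⟨x⟩ := ‹Nonempty X›
  refine ⟨⟨Matrix.diagonal (Pi.single x 1), Matrix.PosSemidef.diagonal fun i => ?_, ?_⟩⟩
  · by_cases h : i = x
    · subst h; simp
    · simp [h]
  · simp [Matrix.trace_diagonal]

theorem exists_real_bound {α : EntropicFormula n} (h : α.IsBounded) :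
    ∃ (A B E : QSystem) (U : ChannelIsometry A B E) (C : ℝ), ∀ x ∈ α.values U, x ≤ C := by
  obtain ⟨A, B, E, U, hU⟩ := h
  obtain ⟨C, hC, -⟩ := EReal.lt_iff_exists_real_btwn.1 hU
  exact ⟨A, B, E, U, C, fun x hx => EReal.coe_le_coe_iff.1
    ((le_sSup (Set.mem_image_of_mem _ hx)).trans hC.le)⟩

/-- A bounded formula takes no positive value without a channel, since this value could be added to
any value any number of times. -/
theorem eval_trivial_nonpos {α : EntropicFormula n} (h : α.IsBounded) {W : Fin n → QSystem}
    (ψ : QState (Joint (inSys W QSystem.trivial))) : α.eval ChannelIsometry.trivial ψ ≤ 0 := by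
  obtain ⟨A, B, E, U, C, hC⟩ := exists_real_bound h
  by_contra! hpos
  obtain ⟨φ⟩ := QState.nonempty (Joint (inSys (fun _ : Fin n => QSystem.trivial) A))
  have key : ∀ k : ℕ, α.eval U φ + k * α.eval ChannelIsometry.trivial ψ ∈ α.values U := by
    intro k
    induction k with
    | zero => exact ⟨_, φ, by simp⟩
    | succ k ih =>
      obtain ⟨V, φ', e⟩ := ih
      refine ⟨_, φ'.prodAux ψ, ?_⟩
      rw [eval_prodAux, e]
      push_cast
      ring
  obtain ⟨k, hk⟩ := exists_nat_gt ((C - α.eval U φ) / α.eval ChannelIsometry.trivial ψ)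
  rw [div_lt_iff₀ hpos] at hk
  linarith [hC _ (key k)]

/-- Regrouping the auxiliary systems by `w` does not decrease the formula. -/
def Raises (α : EntropicFormula n) (w : Fin n → Option (Fin n)) : Prop :=
  ∀ (A B E : QSystem) (U : ChannelIsometry A B E) (V : Fin n → QSystem)
    (φ : QState (Joint (inSys V A))), α.eval U φ ≤ α.eval U (φ.push w)

theorem eval_push (α : EntropicFormula n) (U : ChannelIsometry A B E) {V : Fin m → QSystem}
    (φ : QState (Joint (inSys V A))) (w : Fin m → Option (Fin n)) :
    α.eval U (φ.push w) = ∑ s, α s * outEntropy U φ (pullback w s) := by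
  simp only [eval_eq, outEntropy_push]

theorem raises_some (α : EntropicFormula n) : α.Raises some := by
  intro A B E U V φ
  rw [eval_push, eval_eq]
  refine le_of_eq (Finset.sum_congr rfl fun s _ => ?_)
  rw [OutLabel.finset_ext (s := pullback some s) (t := s) (by simp) (by simp) (by simp)]

/-- Regrouping twice gives nested tensor products, different systems from those of the composite
regrouping, but with the same entropies. -/
theorem Raises.bind {α : EntropicFormula n} {u w : Fin n → Option (Fin n)} (hu : α.Raises u)
    (hw : α.Raises w) : α.Raises fun j => (u j).bind w := by
  intro A B E U V φ
  refine (hu A B E U V φ).trans ((hw A B E U _ (φ.push u)).trans (le_of_eq ?_))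
  rw [eval_push, eval_push]
  simp only [outEntropy_push, pullback_pullback]

/-- With `U₂` trivial, the `hat` term is nonpositive and `φ̃` is just `φ` regrouped. -/
theorem raises_tilde {α : EntropicFormula n} (hb : α.IsBounded) {D : ConsistentDecoupling n}
    (h : α.UniformlySubadditive D) : α.Raises fun j => blockOf D.tilde (.aux j) := by
  intro A B E U V φ
  have h1 := h A B E _ _ _ U ChannelIsometry.trivial V
    (φ.relabelA (A' := A.prod QSystem.trivial) (Equiv.prodPUnit A).symm)
  have h2 := eval_trivial_nonpos hb (D.hatState U
    (φ.relabelA (A' := A.prod QSystem.trivial) (Equiv.prodPUnit A).symm))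
  have h3 : α.eval (U.tensor ChannelIsometry.trivial)
      (φ.relabelA (A' := A.prod QSystem.trivial) (Equiv.prodPUnit A).symm) = α.eval U φ := by
    simp only [eval_eq]
    refine Finset.sum_congr rfl fun s _ => congrArg (α s * ·) (outEntropy_relabel U _ _
      (Equiv.prodPUnit B).symm (Equiv.prodPUnit E).symm (fun a b e => ?_) φ s)
    simp [ChannelIsometry.tensor, ChannelIsometry.trivial]
  have h4 : α.eval U (D.tildeState ChannelIsometry.trivial
      (φ.relabelA (A' := A.prod QSystem.trivial) (Equiv.prodPUnit A).symm)) =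
      α.eval U (φ.push fun j => blockOf D.tilde (.aux j)) := by
    simp only [eval_eq, outEntropy_push]
    refine Finset.sum_congr rfl fun s _ => congrArg (α s * ·) ?_
    rw [ConsistentDecoupling.tildeState, outEntropy_regroup D.tilde_disjoint,
      outEntropy_assoc_trivial_splitSnd, pullback_pullback]
    rfl
  linarith

theorem raises_hat {α : EntropicFormula n} (hb : α.IsBounded) {D : ConsistentDecoupling n}
    (h : α.UniformlySubadditive D) : α.Raises fun j => blockOf D.hat (.aux j) := by
  intro A B E U V φ
  have h1 := h _ _ _ A B E ChannelIsometry.trivial U V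
    (φ.relabelA (A' := QSystem.trivial.prod A) (Equiv.punitProd A).symm)
  have h2 := eval_trivial_nonpos hb (D.tildeState U
    (φ.relabelA (A' := QSystem.trivial.prod A) (Equiv.punitProd A).symm))
  have h3 : α.eval (ChannelIsometry.trivial.tensor U)
      (φ.relabelA (A' := QSystem.trivial.prod A) (Equiv.punitProd A).symm) = α.eval U φ := by
    simp only [eval_eq]
    refine Finset.sum_congr rfl fun s _ => congrArg (α s * ·) (outEntropy_relabel U _ _
      (Equiv.punitProd B).symm (Equiv.punitProd E).symm (fun a b e => ?_) φ s)
    simp [ChannelIsometry.tensor, ChannelIsometry.trivial]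
  have h4 : α.eval U (D.hatState ChannelIsometry.trivial
      (φ.relabelA (A' := QSystem.trivial.prod A) (Equiv.punitProd A).symm)) =
      α.eval U (φ.push fun j => blockOf D.hat (.aux j)) := by
    simp only [eval_eq, outEntropy_push]
    refine Finset.sum_congr rfl fun s _ => congrArg (α s * ·) ?_
    rw [ConsistentDecoupling.hatState, outEntropy_regroup D.hat_disjoint,
      outEntropy_assoc_trivial_splitFst, pullback_pullback]
    rfl
  linarith

/-- The formula that regroups its auxiliary systems by `w` before evaluating `α`. -/
def comap (w : Fin m → Option (Fin n)) (α : EntropicFormula n) : EntropicFormula m := fun s =>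
  ∑ t, if pullback w t = s then α t else 0

theorem eval_comap (w : Fin m → Option (Fin n)) (α : EntropicFormula n)
    (U : ChannelIsometry A B E) {V : Fin m → QSystem} (φ : QState (Joint (inSys V A))) :
    (α.comap w).eval U φ = α.eval U (φ.push w) := by
  rw [eval_push, eval_eq]
  simp only [comap, Finset.sum_mul]
  rw [Finset.sum_comm]
  refine Finset.sum_congr rfl fun t _ => ?_
  rw [Finset.sum_eq_single (pullback w t)]
  · simp
  · intro s _ hs
    simp [Ne.symm hs]
  · simp

end EntropicFormula

/-! ### The decoupling of the remaining systems -/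

section Restrict

variable {n m : ℕ}

/-- The decoupling of the `m` systems embedded by `e` among `n` systems: apply the decoupling `G`,
regroup the result by `w`, and keep the systems in the range of `e`. -/
def restrictBlocks (e : Fin m ↪ Fin n) (G : Fin n → Finset (OutLabel (Fin n)))
    (w : Fin n → Option (Fin n)) (i : Fin m) : Finset (OutLabel (Fin m)) :=
  Finset.univ.filter fun l =>
    ((liftMap (fun j => some (e j)) l).bind (blockOf G)).bind w = some (e i)

theorem mem_restrictBlocks (e : Fin m ↪ Fin n) (G : Fin n → Finset (OutLabel (Fin n)))
    (w : Fin n → Option (Fin n)) (i : Fin m) (l : OutLabel (Fin m)) :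
    l ∈ restrictBlocks e G w i ↔
      ((liftMap (fun j => some (e j)) l).bind (blockOf G)).bind w = some (e i) := by
  simp only [restrictBlocks, Finset.mem_filter, Finset.mem_univ, true_and]

theorem restrictBlocks_disjoint (e : Fin m ↪ Fin n) (G : Fin n → Finset (OutLabel (Fin n)))
    (w : Fin n → Option (Fin n)) (i j : Fin m) (hij : i ≠ j) :
    Disjoint (restrictBlocks e G w i) (restrictBlocks e G w j) := by
  refine Finset.disjoint_left.2 fun l hi hj => hij ?_
  rw [mem_restrictBlocks] at hi hj
  rw [hi, Option.some.injEq] at hj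
  exact e.injective hj

/-- As `w` takes values in the range of `e`, no block is lost when only the embedded indices are
kept. -/
theorem blockOf_restrictBlocks (e : Fin m ↪ Fin n) (G : Fin n → Finset (OutLabel (Fin n)))
    (w : Fin n → Option (Fin n)) (hw : ∀ j i, w j = some i → i ∈ Set.range e)
    (l : OutLabel (Fin m)) :
    (blockOf (restrictBlocks e G w) l).bind (fun j => some (e j)) =
      ((liftMap (fun j => some (e j)) l).bind (blockOf G)).bind w := by
  ext k
  rw [Option.bind_eq_some_iff]
  constructor
  · rintro ⟨i, hi, hk⟩
    rw [blockOf_eq_some_iff (restrictBlocks_disjoint e G w), mem_restrictBlocks] at hi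
    rw [hi, hk]
  · intro h
    obtain ⟨j, -, hj⟩ := Option.bind_eq_some_iff.1 h
    obtain ⟨i, rfl⟩ := hw j k hj
    exact ⟨i, (blockOf_eq_some_iff (restrictBlocks_disjoint e G w) _ _).2
      ((mem_restrictBlocks ..).2 h), rfl⟩

/-- The hypothesis sends `e j` to itself, so the only auxiliary system in block `i` is the one with
`j = i`; `B` and `E` may lie in any block or none. -/
theorem restrictBlocks_standard (e : Fin m ↪ Fin n) (G : Fin n → Finset (OutLabel (Fin n)))
    (w : Fin n → Option (Fin n))
    (hw : ∀ i, (blockOf G (.aux (e i))).bind w = some (e i)) (i : Fin m) :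
    ∃ M ⊆ ({.B, .E} : Finset (OutLabel (Fin m))), restrictBlocks e G w i = M ∪ {.aux i} := by
  refine ⟨restrictBlocks e G w i ∩ {.B, .E}, Finset.inter_subset_right, ?_⟩
  refine OutLabel.finset_ext (fun j => ?_) (by simp) (by simp)
  have h : (liftMap (fun j => some (e j)) (.aux j)).bind (blockOf G) = blockOf G (.aux (e j)) := rfl
  simp [mem_restrictBlocks, h, hw, e.injective.eq_iff]

end Restrict

/-! ### Subadditivity and values of the restricted formula -/

namespace EntropicFormula

variable {n m : ℕ}

/-- Subadditivity of `α` is applied to the state extended by one-dimensional systems; then `wt` and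
`wh` raise one term each. The resulting regroupings are those of the restricted decoupling followed
by `e`. -/
theorem UniformlySubadditive.comap {α : EntropicFormula n} {D : ConsistentDecoupling n}
    (h : α.UniformlySubadditive D) (e : Fin m ↪ Fin n) {wt wh : Fin n → Option (Fin n)}
    (ht : α.Raises wt) (hh : α.Raises wh) (hte : ∀ j i, wt j = some i → i ∈ Set.range e)
    (hhe : ∀ j i, wh j = some i → i ∈ Set.range e) :
    (α.comap fun j => some (e j)).UniformlySubadditive
      { tilde := restrictBlocks e D.tilde wt
        hat := restrictBlocks e D.hat wh
        tilde_disjoint := restrictBlocks_disjoint e D.tilde wt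
        hat_disjoint := restrictBlocks_disjoint e D.hat wh } := by
  intro A₁ B₁ E₁ A₂ B₂ E₂ U₁ U₂ V φ
  rw [eval_comap, eval_comap, eval_comap]
  refine (h _ _ _ _ _ _ U₁ U₂ _ _).trans (add_le_add ((ht _ _ _ _ _ _).trans (le_of_eq ?_))
    ((hh _ _ _ _ _ _).trans (le_of_eq ?_)))
  · rw [eval_push, eval_push]
    refine Finset.sum_congr rfl fun s _ => congrArg (α s * ·) ?_
    rw [outEntropy_tildeState_push, pullback_pullback, ConsistentDecoupling.tildeState,
      outEntropy_regroup (restrictBlocks_disjoint e D.tilde wt), pullback_pullback]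
    simp only [blockOf_restrictBlocks e D.tilde wt hte]
  · rw [eval_push, eval_push]
    refine Finset.sum_congr rfl fun s _ => congrArg (α s * ·) ?_
    rw [outEntropy_hatState_push, pullback_pullback, ConsistentDecoupling.hatState,
      outEntropy_regroup (restrictBlocks_disjoint e D.hat wh), pullback_pullback]
    simp only [blockOf_restrictBlocks e D.hat wh hhe]

/-- If regrouping into the systems in the range of `e` does not decrease `α`, then `α` can be
maximized with these auxiliary systems only. -/
theorem exists_le_eval_comap {α : EntropicFormula n} (e : Fin m ↪ Fin n)
    {w : Fin n → Option (Fin n)} (hw : α.Raises w) (he : ∀ j i, w j = some i → i ∈ Set.range e)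
    {A B E : QSystem} (U : ChannelIsometry A B E) {x : ℝ} (hx : x ∈ α.values U) :
    ∃ y ∈ (α.comap fun j => some (e j)).values U, x ≤ y := by
  obtain ⟨V, φ, rfl⟩ := hx
  -- This is `w` with its values read in `Fin m`; followed by `e` it is `w` again.
  let w' : Fin n → Option (Fin m) := fun j => (w j).bind (Function.partialInv e)
  refine ⟨_, ⟨_, φ.push w', rfl⟩, (hw _ _ _ _ _ _).trans (le_of_eq ?_)⟩
  rw [eval_comap, eval_push, eval_push]
  refine Finset.sum_congr rfl fun s _ => congrArg (α s * ·) ?_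
  rw [outEntropy_push, pullback_pullback]
  congr 2
  funext j
  cases hj : w j with
  | none => simp [w', hj]
  | some i =>
    obtain ⟨k, rfl⟩ := he j i hj
    simp [w', hj, Function.partialInv_left e.injective]

end EntropicFormula

/-- A cofinal subset has the same upper bounds, and a greatest element of `S` must already lie in
`T`. -/
theorem sSup_eq_and_isGreatest_iff {S T : Set ℝ} (h : T ⊆ S) (h' : ∀ x ∈ S, ∃ y ∈ T, x ≤ y) :
    sSup ((fun x : ℝ => (x : EReal)) '' S) = sSup ((fun x : ℝ => (x : EReal)) '' T) ∧
      ∀ x, IsGreatest S x ↔ IsGreatest T x := by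
  refine ⟨le_antisymm (sSup_le ?_) (sSup_le_sSup (Set.image_mono h)), fun x => ⟨?_, ?_⟩⟩
  · rintro _ ⟨x, hx, rfl⟩
    obtain ⟨y, hy, hxy⟩ := h' x hx
    exact (EReal.coe_le_coe_iff.2 hxy).trans (le_sSup (Set.mem_image_of_mem _ hy))
  · rintro ⟨hx, hmax⟩
    obtain ⟨y, hy, hxy⟩ := h' x hx
    exact ⟨le_antisymm hxy (hmax (h hy)) ▸ hy, fun z hz => hmax (h hz)⟩
  · rintro ⟨hx, hmax⟩
    refine ⟨h hx, fun z hz => ?_⟩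
    obtain ⟨y, hy, hzy⟩ := h' z hz
    exact hzy.trans (hmax hy)

end

theorem mainTheorem6 (n : ℕ) (α : EntropicFormula n) (hbdd : α.IsBounded)
    (D : ConsistentDecoupling n) (hD : ¬ D.IsStandard) (hα : α.UniformlySubadditive D) :
    ∃ m ≤ n, ∃ (β : EntropicFormula m) (D' : ConsistentDecoupling m),
      D'.IsStandard ∧ β.UniformlySubadditive D' ∧
      ∀ (A B E : QSystem) (U : ChannelIsometry A B E),
        α.maxValue U = β.maxValue U ∧
        ∀ x : ℝ, IsGreatest (α.values U) x ↔ IsGreatest (β.values U) x := by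
  classical
  -- The set `P` depends only on the monoid, so the same `P` serves both `tilde` and `hat`, with
  -- different left inverses.
  obtain ⟨P, hP⟩ := exists_range_leftInverse {w | α.Raises w} α.raises_some
    fun u hu w hw => hu.bind hw
  obtain ⟨wt, ht, htP, hte⟩ := hP _ (EntropicFormula.raises_tilde hbdd hα)
  obtain ⟨wh, hh, hhP, hhe⟩ := hP _ (EntropicFormula.raises_hat hbdd hα)
  let e : Fin (Fintype.card P) ↪ Fin n :=
    (Fintype.equivFin P).symm.toEmbedding.trans (Function.Embedding.subtype _)
  have hmem : ∀ i, e i ∈ P := fun i => ((Fintype.equivFin P).symm i).2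
  have hrange : ∀ i ∈ P, i ∈ Set.range e := fun i hi =>
    ⟨Fintype.equivFin P ⟨i, hi⟩, by simp [e]⟩
  refine ⟨Fintype.card P, by simpa using Fintype.card_le_of_embedding e, _, _, fun i => ⟨?_, ?_⟩,
    hα.comap e ht hh (fun j i h => hrange i (htP j i h)) fun j i h => hrange i (hhP j i h),
    fun A B E U => sSup_eq_and_isGreatest_iff ?_ fun x hx => EntropicFormula.exists_le_eval_comap e
      ht (fun j i h => hrange i (htP j i h)) U hx⟩
  · exact restrictBlocks_standard e D.tilde wt (fun i => hte _ (hmem i)) i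
  · exact restrictBlocks_standard e D.hat wh (fun i => hhe _ (hmem i)) i
  · rintro x ⟨V, φ, rfl⟩
    exact ⟨_, _, (α.eval_comap _ U φ).symm⟩
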